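/- Let $E=(E^0,E^1,\mathbf s,\mathbf r)$ be an arbitrary directed graph, $K$ a field with an involution $*$ (possibly the identity), and let $L_K(E)$ be the Leavitt path algebra: the free associative (not necessarily unital) $K$-algebra generated by $E^0\cup E^1\cup\{e^*: e\in E^1\}$ subject to, for all vertices $v,w$ and edges $e,f$: $vw=\delta_{v,w}v$; $\mathbf s(e)e=e\,\mathbf r(e)=e$; $\mathbf r(e)e^*=e^*\mathbf s(e)=e^*$; $e^*f=\delta_{e,f}\mathbf r(e)$; and $v=\sum_{e\in\mathbf s^{-1}(v)}ee^*$ whenever $v$ is regular (i.e. $\mathbf s^{-1}(v)$ is nonempty and finite). It carries the involution $(\sum_i a_ip_iq_i^*)^*=\sum_i a_i^*q_ip_i^*$ for $a_i\in K$ and paths $p_i,q_i$, where vertices are paths of length zero. Let $R$ be an involutive $K$-algebra: an associative, not necessarily unital, $K$-algebra with an involution satisfying $(ax)^*=a^*x^*$ for $a\in K$, $x\in R$. In a $*$-ring, $x\ge 0$ ($x$ is positive) means that $x$ is a finite sum of elements $yy^*$; $x>0$ means $x\ge 0$ and $x\ne 0$; $x\ge y$ means $x-y\ge 0$; and the ring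 is positive definite if $\sum_{i=1}^n x_ix_i^*=0$ implies $x_1=\dots=x_n=0$. An $R$-valued graph trace on $E$ is a map $\delta:E^0\to R$ with $\delta(v)=\sum_{e\in\mathbf s^{-1}(v)}\delta(\mathbf r(e))$ for every regular vertex $v$. It is positive if $\delta(v)\ge\sum_{e\in I}\delta(\mathbf r(e))$ for every vertex $v$ and every finite (possibly empty) $I\subseteq\mathbf s^{-1}(v)$, and faithful if moreover $\delta(v)>0$ for every vertex $v$. An $R$-valued trace on $L_K(E)$ is an additive map $t:L_K(E)\to R$ with $t(xy)=t(yx)$ for all $x,y$. It is canonical if $t(pq^*)=\delta_{|p|,|q|}t(pq^*)=\delta_{p,q}t(pq^*)=\delta_{p,q}t(\mathbf r(p))$ for all paths $p,q$; positive if $x\ge 0$ implies $t(x)\ge 0$; and faithful if $x>0$ implies $t(x)>0$. **Theorem.** There is a bijection $\tau$ from the set of $R$-valued graph traces on $E$ to the set of canonical, $K$-linear, $R$-valued traces on $L_K(E)$ such that $\tau(\delta)$ extends $\delta$, i.e. $\tau(\delta)(v)=\delta(v)$ for every vertex $v$ (this determines $\tau$), and $\tau$ restricts to a bijection from the positive $R$-valued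 graph traces on $E$ onto the positive, canonical, $K$-linear, $R$-valued traces on $L_K(E)$. If $R$ is positive definite, $\tau$ also restricts to a bijection from the faithful $R$-valued graph traces on $E$ onto the faithful, canonical, $K$-linear, $R$-valued traces on $L_K(E)$. -/

import Mathlib

universe u v w

/-! ### Involutive rings: positive elements, positive definite involutions, traces -/

/-- `x ≥ 0`: the element `x` is a finite sum of elements of the form `y y*`. -/
def IsPosElt {R : Type*} [NonUnitalRing R] [StarRing R] (x : R) : Prop :=
  ∃ (n : ℕ) (y : Fin n → R), x = ∑ i, y i * star (y i)

/-- `x > 0`: the element `x` is positive and nonzero. -/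
def IsStrictPosElt {R : Type*} [NonUnitalRing R] [StarRing R] (x : R) : Prop :=
  IsPosElt x ∧ x ≠ 0

/-- The involution of `R` is positive definite. -/
def IsPosDefStarRing (R : Type*) [NonUnitalRing R] [StarRing R] : Prop :=
  ∀ (n : ℕ) (x : Fin n → R), ∑ i, x i * star (x i) = 0 → ∀ i, x i = 0

/-- A `T`-valued trace on `R`: an additive, central map. -/
def IsTrace {R T : Type*} [NonUnitalRing R] [NonUnitalRing T] (t : R → T) : Prop :=
  (∀ x y, t (x + y) = t x + t y) ∧ ∀ x y, t (x * y) = t (y * x)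

/-- `C`-linearity (homogeneity) of a trace. -/
def IsScalarLinear (C : Type*) {R T : Type*} [SMul C R] [SMul C T] (t : R → T) : Prop :=
  ∀ (c : C) (x : R), t (c • x) = c • t x

/-- A positive map: `t x ≥ 0` whenever `x ≥ 0`. -/
def IsPositiveMap {R T : Type*} [NonUnitalRing R] [StarRing R] [NonUnitalRing T] [StarRing T]
    (t : R → T) : Prop :=
  ∀ x, IsPosElt x → IsPosElt (t x)

/-- A faithful map: `t x > 0` whenever `x > 0`. -/
def IsFaithfulMap {R T : Type*} [NonUnitalRing R] [StarRing R] [NonUnitalRing T] [StarRing T]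
    (t : R → T) : Prop :=
  ∀ x, IsStrictPosElt x → IsStrictPosElt (t x)

/-! ### Directed graphs, paths, graph traces -/

/-- A directed graph with vertex set `V` and edge set `Ed` (loops, multiple edges, infinitely many
vertices and edges are allowed). -/
structure DirGraph (V : Type u) (Ed : Type v) where
  /-- the source map -/
  src : Ed → V
  /-- the range map -/
  rng : Ed → V

namespace DirGraph

variable {V : Type u} {Ed : Type v}

/-- A path `e₁ … eₙ`, `n ≥ 0`. It is recorded together with its source, so that the paths of
length zero are exactly the vertices. -/
@[ext]
structure Path (E : DirGraph V Ed) where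
  /-- the source of the path -/
  source : V
  /-- the edges `e₁, …, eₙ` of the path -/
  edges : List Ed
  /-- the source of the path is the source of its first edge -/
  source_eq : ∀ e ∈ edges.head?, E.src e = source
  /-- `r(eᵢ) = s(eᵢ₊₁)` -/
  chain : edges.IsChain (fun e f => E.rng e = E.src f)

/-- The length of a path. -/
def Path.length {E : DirGraph V Ed} (p : E.Path) : ℕ := p.edges.length

/-- The range of a path: the range of its last edge, or the vertex itself for length zero. -/
def Path.range {E : DirGraph V Ed} (p : E.Path) : V :=
  p.edges.foldl (fun _ e => E.rng e) p.source

/-- A graph trace: for every regular vertex `v` (one that emits a nonempty finite set `I` of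
edges), `δ(v) = ∑_{e ∈ s⁻¹(v)} δ(r(e))`. -/
def IsGraphTrace {R : Type*} [NonUnitalRing R] (E : DirGraph V Ed) (δ : V → R) : Prop :=
  ∀ (v : V) (I : Finset Ed), (I : Set Ed) = E.src ⁻¹' {v} → I.Nonempty →
    δ v = ∑ e ∈ I, δ (E.rng e)

/-- Positivity of a graph trace: `δ(v) ≥ ∑_{e ∈ I} δ(r(e))` for every vertex `v` and every finite
subset `I` of `s⁻¹(v)`. -/
def IsPositiveOnGraph {R : Type*} [NonUnitalRing R] [StarRing R] (E : DirGraph V Ed)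
    (δ : V → R) : Prop :=
  ∀ (v : V) (I : Finset Ed), (I : Set Ed) ⊆ E.src ⁻¹' {v} →
    IsPosElt (δ v - ∑ e ∈ I, δ (E.rng e))

/-- Faithfulness of a graph trace: it is positive and `δ(v) > 0` for every vertex `v`. -/
def IsFaithfulOnGraph {R : Type*} [NonUnitalRing R] [StarRing R] (E : DirGraph V Ed)
    (δ : V → R) : Prop :=
  E.IsPositiveOnGraph δ ∧ ∀ v, IsStrictPosElt (δ v)

end DirGraph

/-! ### The Leavitt path algebra -/

namespace Leavitt

/-- Formal expressions in vertices, edges and ghost edges, with coefficients in `K`. -/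
inductive Pre (K : Type w) (V : Type u) (Ed : Type v) : Type (max u v w)
  | vertex : V → Pre K V Ed
  | edge : Ed → Pre K V Ed
  | ghost : Ed → Pre K V Ed
  | zero : Pre K V Ed
  | add : Pre K V Ed → Pre K V Ed → Pre K V Ed
  | mul : Pre K V Ed → Pre K V Ed → Pre K V Ed
  | smul : K → Pre K V Ed → Pre K V Ed

/-- The formal expression `e₁e₁* + (e₂e₂* + (… + 0))`. -/
def Pre.sumProj {K : Type w} {V : Type u} {Ed : Type v} (l : List Ed) : Pre K V Ed :=
  l.foldr (fun e a => .add (.mul (.edge e) (.ghost e)) a) .zero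

/-- The relations: those of an associative (not necessarily unital) `K`-algebra, compatibility
with the operations, and (V), (E1), (E2), (CK1), (CK2). In (CK2), the list `l` enumerates
`s⁻¹(v)` without repetition, and is nonempty; such a list exists if and only if `v` is regular. -/
inductive Rel {V : Type u} {Ed : Type v} (K : Type w) [Field K] (E : DirGraph V Ed) :
    Pre K V Ed → Pre K V Ed → Prop
  | symm {a b : Pre K V Ed} : Rel K E a b → Rel K E b a
  | add_congr_left {a b : Pre K V Ed} (c : Pre K V Ed) : Rel K E a b → Rel K E (.add a c) (.add b c)
  | add_congr_right {a b : Pre K V Ed} (c : Pre K V Ed) :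
      Rel K E a b → Rel K E (.add c a) (.add c b)
  | mul_congr_left {a b : Pre K V Ed} (c : Pre K V Ed) : Rel K E a b → Rel K E (.mul a c) (.mul b c)
  | mul_congr_right {a b : Pre K V Ed} (c : Pre K V Ed) :
      Rel K E a b → Rel K E (.mul c a) (.mul c b)
  | smul_congr {a b : Pre K V Ed} (k : K) : Rel K E a b → Rel K E (.smul k a) (.smul k b)
  | add_assoc (a b c : Pre K V Ed) : Rel K E (.add (.add a b) c) (.add a (.add b c))
  | add_comm (a b : Pre K V Ed) : Rel K E (.add a b) (.add b a)
  | zero_add (a : Pre K V Ed) : Rel K E (.add .zero a) a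
  | mul_assoc (a b c : Pre K V Ed) : Rel K E (.mul (.mul a b) c) (.mul a (.mul b c))
  | add_mul (a b c : Pre K V Ed) : Rel K E (.mul (.add a b) c) (.add (.mul a c) (.mul b c))
  | mul_add (a b c : Pre K V Ed) : Rel K E (.mul a (.add b c)) (.add (.mul a b) (.mul a c))
  | one_smul (a : Pre K V Ed) : Rel K E (.smul 1 a) a
  | zero_smul (a : Pre K V Ed) : Rel K E (.smul 0 a) .zero
  | mul_smul (k l : K) (a : Pre K V Ed) : Rel K E (.smul (k * l) a) (.smul k (.smul l a))
  | add_smul (k l : K) (a : Pre K V Ed) :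
      Rel K E (.smul (k + l) a) (.add (.smul k a) (.smul l a))
  | smul_add (k : K) (a b : Pre K V Ed) :
      Rel K E (.smul k (.add a b)) (.add (.smul k a) (.smul k b))
  | smul_mul (k : K) (a b : Pre K V Ed) : Rel K E (.mul (.smul k a) b) (.smul k (.mul a b))
  | mul_smul_comm (k : K) (a b : Pre K V Ed) : Rel K E (.mul a (.smul k b)) (.smul k (.mul a b))
  | v_self (x : V) : Rel K E (.mul (.vertex x) (.vertex x)) (.vertex x)
  | v_ne (x y : V) : x ≠ y → Rel K E (.mul (.vertex x) (.vertex y)) .zero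
  | e1_left (e : Ed) : Rel K E (.mul (.vertex (E.src e)) (.edge e)) (.edge e)
  | e1_right (e : Ed) : Rel K E (.mul (.edge e) (.vertex (E.rng e))) (.edge e)
  | e2_left (e : Ed) : Rel K E (.mul (.vertex (E.rng e)) (.ghost e)) (.ghost e)
  | e2_right (e : Ed) : Rel K E (.mul (.ghost e) (.vertex (E.src e))) (.ghost e)
  | ck1_self (e : Ed) : Rel K E (.mul (.ghost e) (.edge e)) (.vertex (E.rng e))
  | ck1_ne (e f : Ed) : e ≠ f → Rel K E (.mul (.ghost e) (.edge f)) .zero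
  | ck2 (x : V) (l : List Ed) : l.Nodup → l ≠ [] → (∀ e, e ∈ l ↔ E.src e = x) →
      Rel K E (.vertex x) (Pre.sumProj l)

/-- The involution on formal expressions: it fixes the vertices, exchanges `e` and `e*`, reverses
products and applies the involution of `K` to the scalars. -/
def Pre.conj {K : Type w} [Star K] {V : Type u} {Ed : Type v} : Pre K V Ed → Pre K V Ed
  | .vertex x => .vertex x
  | .edge e => .ghost e
  | .ghost e => .edge e
  | .zero => .zero
  | .add a b => .add a.conj b.conj
  | .mul a b => .mul b.conj a.conj
  | .smul k a => .smul (star k) a.conj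

theorem Pre.conj_sumProj {K : Type w} [Star K] {V : Type u} {Ed : Type v} (l : List Ed) :
    (Pre.sumProj l : Pre K V Ed).conj = Pre.sumProj l := by
  induction l with
  | nil => rfl
  | cons e l ih =>
    change Pre.add (.mul (.edge e) (.ghost e)) (Pre.sumProj l : Pre K V Ed).conj = _
    rw [ih]; rfl

theorem Pre.conj_conj {K : Type w} [Field K] [StarRing K] {V : Type u} {Ed : Type v}
    (a : Pre K V Ed) : a.conj.conj = a := by
  induction a <;> simp_all [Pre.conj]

theorem Rel.conj {V : Type u} {Ed : Type v} {K : Type w} [Field K] [StarRing K]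
    {E : DirGraph V Ed} {a b : Pre K V Ed} (h : Rel K E a b) : Rel K E a.conj b.conj := by
  induction h with
  | add_congr_left c _ ih => exact .add_congr_left _ ih
  | add_congr_right c _ ih => exact .add_congr_right _ ih
  | mul_congr_left c _ ih => exact .mul_congr_right _ ih
  | mul_congr_right c _ ih => exact .mul_congr_left _ ih
  | smul_congr k _ ih => exact .smul_congr _ ih
  | add_assoc a b c => exact .add_assoc _ _ _
  | add_comm a b => exact .add_comm _ _
  | zero_add a => exact .zero_add _
  | symm _ ih => exact .symm ih
  | mul_assoc a b c => exact .symm (.mul_assoc _ _ _)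
  | add_mul a b c => exact .mul_add _ _ _
  | mul_add a b c => exact .add_mul _ _ _
  | one_smul a => simpa [Pre.conj] using Rel.one_smul a.conj
  | zero_smul a => simpa [Pre.conj] using Rel.zero_smul a.conj
  | mul_smul k l a => simpa [Pre.conj, mul_comm] using Rel.mul_smul (star k) (star l) a.conj
  | add_smul k l a => simpa [Pre.conj] using Rel.add_smul (star k) (star l) a.conj
  | smul_add k a b => exact .smul_add _ _ _
  | smul_mul k a b => exact .mul_smul_comm _ _ _
  | mul_smul_comm k a b => exact .smul_mul _ _ _
  | v_self x => exact .v_self x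
  | v_ne x y h => exact .v_ne y x h.symm
  | e1_left e => exact .e2_right e
  | e1_right e => exact .e2_left e
  | e2_left e => exact .e1_right e
  | e2_right e => exact .e1_left e
  | ck1_self e => exact .ck1_self e
  | ck1_ne e f h => exact .ck1_ne f e h.symm
  | ck2 x l h1 h2 h3 => rw [Pre.conj_sumProj]; exact .ck2 x l h1 h2 h3

end Leavitt

/-- The Leavitt path algebra `L_K(E)`: the free associative, not necessarily unital, `K`-algebra on
the vertices, edges and ghost edges of `E`, subject to (V), (E1), (E2), (CK1) and (CK2). -/
def LeavittPathAlgebra (K : Type w) [Field K] {V : Type u} {Ed : Type v} (E : DirGraph V Ed) :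
    Type (max u v w) :=
  Quot (Leavitt.Rel K E)

namespace LeavittPathAlgebra

open Leavitt

variable {V : Type u} {Ed : Type v} {K : Type w} [Field K] {E : DirGraph V Ed}

instance : Zero (LeavittPathAlgebra K E) := ⟨Quot.mk _ .zero⟩

instance : Add (LeavittPathAlgebra K E) :=
  ⟨Quot.map₂ .add (fun c _ _ h => .add_congr_right c h) (fun _ _ c h => .add_congr_left c h)⟩

instance : Mul (LeavittPathAlgebra K E) :=
  ⟨Quot.map₂ .mul (fun c _ _ h => .mul_congr_right c h) (fun _ _ c h => .mul_congr_left c h)⟩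

instance : SMul K (LeavittPathAlgebra K E) :=
  ⟨fun k => Quot.map (.smul k) (fun _ _ h => .smul_congr k h)⟩

instance : Neg (LeavittPathAlgebra K E) := ⟨fun a => (-1 : K) • a⟩

protected theorem zero_smul' (a : LeavittPathAlgebra K E) : (0 : K) • a = 0 := by
  induction a using Quot.ind with | _ a => exact Quot.sound (.zero_smul a)

protected theorem smul_mul' (k : K) (a b : LeavittPathAlgebra K E) :
    (k • a) * b = k • (a * b) := by
  induction a using Quot.ind with | _ a =>
  induction b using Quot.ind with | _ b => exact Quot.sound (.smul_mul k a b)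

protected theorem mul_smul_comm' (k : K) (a b : LeavittPathAlgebra K E) :
    a * (k • b) = k • (a * b) := by
  induction a using Quot.ind with | _ a =>
  induction b using Quot.ind with | _ b => exact Quot.sound (.mul_smul_comm k a b)

protected theorem add_comm' (a b : LeavittPathAlgebra K E) : a + b = b + a := by
  induction a using Quot.ind with | _ a =>
  induction b using Quot.ind with | _ b => exact Quot.sound (.add_comm a b)

protected theorem zero_add' (a : LeavittPathAlgebra K E) : 0 + a = a := by
  induction a using Quot.ind with | _ a => exact Quot.sound (.zero_add a)

protected theorem one_smul' (a : LeavittPathAlgebra K E) : (1 : K) • a = a := by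
  induction a using Quot.ind with | _ a => exact Quot.sound (.one_smul a)

protected theorem add_smul' (k l : K) (a : LeavittPathAlgebra K E) :
    (k + l) • a = k • a + l • a := by
  induction a using Quot.ind with | _ a => exact Quot.sound (.add_smul k l a)

protected theorem mul_smul' (k l : K) (a : LeavittPathAlgebra K E) :
    (k * l) • a = k • l • a := by
  induction a using Quot.ind with | _ a => exact Quot.sound (.mul_smul k l a)

instance : NonUnitalRing (LeavittPathAlgebra K E) where
  add_assoc a b c := by
    induction a using Quot.ind with | _ a =>
    induction b using Quot.ind with | _ b =>
    induction c using Quot.ind with | _ c => exact Quot.sound (.add_assoc a b c)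
  zero_add := LeavittPathAlgebra.zero_add'
  add_zero a := by rw [LeavittPathAlgebra.add_comm', LeavittPathAlgebra.zero_add']
  add_comm := LeavittPathAlgebra.add_comm'
  nsmul := nsmulRec
  zsmul := zsmulRec
  neg_add_cancel a := by
    change (-1 : K) • a + a = 0
    conv_lhs => rhs; rw [← LeavittPathAlgebra.one_smul' a]
    rw [← LeavittPathAlgebra.add_smul', neg_add_cancel, LeavittPathAlgebra.zero_smul']
  left_distrib a b c := by
    induction a using Quot.ind with | _ a =>
    induction b using Quot.ind with | _ b =>
    induction c using Quot.ind with | _ c => exact Quot.sound (.mul_add a b c)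
  right_distrib a b c := by
    induction a using Quot.ind with | _ a =>
    induction b using Quot.ind with | _ b =>
    induction c using Quot.ind with | _ c => exact Quot.sound (.add_mul a b c)
  zero_mul a := by
    rw [← LeavittPathAlgebra.zero_smul' (0 : LeavittPathAlgebra K E),
      LeavittPathAlgebra.smul_mul', LeavittPathAlgebra.zero_smul', LeavittPathAlgebra.zero_smul']
  mul_zero a := by
    rw [← LeavittPathAlgebra.zero_smul' (0 : LeavittPathAlgebra K E),
      LeavittPathAlgebra.mul_smul_comm', LeavittPathAlgebra.zero_smul',
      LeavittPathAlgebra.zero_smul']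
  mul_assoc a b c := by
    induction a using Quot.ind with | _ a =>
    induction b using Quot.ind with | _ b =>
    induction c using Quot.ind with | _ c => exact Quot.sound (.mul_assoc a b c)

instance : Module K (LeavittPathAlgebra K E) where
  one_smul := LeavittPathAlgebra.one_smul'
  mul_smul := LeavittPathAlgebra.mul_smul'
  smul_zero k := by
    rw [← LeavittPathAlgebra.zero_smul' (0 : LeavittPathAlgebra K E),
      ← LeavittPathAlgebra.mul_smul', mul_zero]
  smul_add k a b := by
    induction a using Quot.ind with | _ a =>
    induction b using Quot.ind with | _ b => exact Quot.sound (.smul_add k a b)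
  add_smul := LeavittPathAlgebra.add_smul'
  zero_smul := LeavittPathAlgebra.zero_smul'

instance : IsScalarTower K (LeavittPathAlgebra K E) (LeavittPathAlgebra K E) :=
  ⟨fun k a b => LeavittPathAlgebra.smul_mul' k a b⟩

instance : SMulCommClass K (LeavittPathAlgebra K E) (LeavittPathAlgebra K E) :=
  ⟨fun k a b => (LeavittPathAlgebra.mul_smul_comm' k a b).symm⟩

variable (K E) in
/-- The vertex `x` as an element of `L_K(E)`. -/
def vertex (x : V) : LeavittPathAlgebra K E := Quot.mk _ (.vertex x)

variable (K E) in
/-- The edge `e` as an element of `L_K(E)`. -/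
def edge (e : Ed) : LeavittPathAlgebra K E := Quot.mk _ (.edge e)

variable (K E) in
/-- The ghost edge `e*` as an element of `L_K(E)`. -/
def ghost (e : Ed) : LeavittPathAlgebra K E := Quot.mk _ (.ghost e)

/-- The involution of `L_K(E)`: the conjugate-linear anti-automorphism that fixes the vertices and
exchanges `e` and `e*`, so that `(∑ aᵢ pᵢ qᵢ*)* = ∑ aᵢ* qᵢ pᵢ*`. -/
instance [StarRing K] : StarRing (LeavittPathAlgebra K E) where
  star := Quot.map Pre.conj (fun _ _ h => h.conj)
  star_involutive a := by
    induction a using Quot.ind with | _ a => exact congrArg (Quot.mk _) a.conj_conj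
  star_mul a b := by
    induction a using Quot.ind with | _ a =>
    induction b using Quot.ind with | _ b => rfl
  star_add a b := by
    induction a using Quot.ind with | _ a =>
    induction b using Quot.ind with | _ b => rfl

instance [StarRing K] : StarModule K (LeavittPathAlgebra K E) :=
  ⟨fun k a => by induction a using Quot.ind with | _ a => rfl⟩

variable (K) in
/-- The path `p = e₁ … eₙ` as the element `s(p) e₁ ⋯ eₙ` of `L_K(E)`. -/
def path (p : E.Path) : LeavittPathAlgebra K E :=
  p.edges.foldl (fun a e => a * edge K E e) (vertex K E p.source)

variable (K) in
/-- The ghost path `p* = eₙ* ⋯ e₁*` as the element `eₙ* ⋯ e₁* s(p)` of `L_K(E)`. -/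
def ghostPath (p : E.Path) : LeavittPathAlgebra K E :=
  p.edges.foldl (fun a e => ghost K E e * a) (vertex K E p.source)

open Classical in
/-- A map `t` on `L_K(E)` is canonical if, for all paths `p` and `q`,
`t(pq*) = δ_{|p|,|q|} t(pq*) = δ_{p,q} t(pq*) = δ_{p,q} t(r(p))`. -/
def IsCanonical {R : Type*} [NonUnitalRing R] (t : LeavittPathAlgebra K E → R) : Prop :=
  ∀ p q : E.Path,
    t (path K p * ghostPath K q) =
        (if p.length = q.length then t (path K p * ghostPath K q) else 0) ∧
    t (path K p * ghostPath K q) = (if p = q then t (path K p * ghostPath K q) else 0) ∧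
    t (path K p * ghostPath K q) = (if p = q then t (vertex K E p.range) else 0)

end LeavittPathAlgebra

/-! The products `p q*` span `L_K(E)`, so a canonical linear trace is determined by its values on
vertices; the trace identity `T(ee*) = T(e*e)` and (CK2) force these values to form a graph trace.
The work is in existence and in positivity.

Existence. No basis of `L_K(E)` is used. Instead `L_K(E)` acts on functionals by `(a·F)(y) = F(ya)`,
where `F` is a table of values on symbols `p q*` satisfying the linear form of (CK2). Checking the
defining relations on this module (`preAct_rel`) turns every such table into a linear map on
`L_K(E)`, its value at `x` being `(x·F)(1)`. For the table `p q* ↦ δ_{p,q} δ(r(p))`, the (CK2)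
condition is exactly the graph trace equation. Another table shows that vertices are nonzero.
Centrality is checked for a generator against a monomial and then spreads to products.

Positivity. Write `x = x₀ + ∑_{e ∈ I} y_e e*` with `x₀` a combination of paths. Moving `x₀ee*` into
the sum gives `x = z + ∑ w_e e*` with `ze = 0` for `e ∈ I`, hence `xx* = zz* + ∑ w_e w_e*`. The
`w_e` have shorter ghost parts, so induction applies, while `T(zz*)` is a combination, with
coefficients `cc*`, of the differences `δ(v) - ∑ δ(r(e))` over finite sets of edges leaving `v`,
which are positive by hypothesis. If `R` is positive definite and `T(xx*) = 0`, every summand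
vanishes, and faithfulness of `δ` with (CK2) yields `x = 0`. This is
`IsCanonical.isPosElt_mul_star`. Conversely, `v - ∑ ee*` is a self-adjoint idempotent, hence
positive, so positivity of `T` gives that of `δ`. -/

namespace DirGraph

variable {V : Type u} {Ed : Type v} (E : DirGraph V Ed)

/-! ### Paths as lists of edges with a prescribed range. -/

/-- The source of the list of edges `q`, read as a path with range `m`. -/
def headVertex (m : V) : List Ed → V
  | [] => m
  | e :: _ => E.src e

/-- The list of edges `q` is a path with range `m`. -/
def IsPathTo (m : V) : List Ed → Prop
  | [] => True
  | e :: q => E.headVertex m q = E.rng e ∧ IsPathTo m q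

@[simp] theorem headVertex_nil (m : V) : E.headVertex m [] = m := rfl

@[simp] theorem headVertex_cons (m : V) (e : Ed) (q : List Ed) :
    E.headVertex m (e :: q) = E.src e := rfl

@[simp] theorem isPathTo_nil (m : V) : E.IsPathTo m [] := trivial

@[simp] theorem isPathTo_cons (m : V) (e : Ed) (q : List Ed) :
    E.IsPathTo m (e :: q) ↔ E.headVertex m q = E.rng e ∧ E.IsPathTo m q := Iff.rfl

@[simp] theorem headVertex_append_singleton (m : V) (e : Ed) (q : List Ed) :
    E.headVertex m (q ++ [e]) = E.headVertex (E.src e) q := by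
  cases q <;> rfl

@[simp] theorem isPathTo_append_singleton (m : V) (e : Ed) (q : List Ed) :
    E.IsPathTo m (q ++ [e]) ↔ m = E.rng e ∧ E.IsPathTo (E.src e) q := by
  induction q with
  | nil => simp
  | cons f q ih => simp [ih]; tauto

namespace Path

variable {E}

theorem foldl_isPathTo (x : V) (l : List Ed) (hs : ∀ e ∈ l.head?, E.src e = x)
    (hc : l.IsChain (fun e f => E.rng e = E.src f)) :
    E.headVertex (l.foldl (fun _ e => E.rng e) x) l = x ∧
      E.IsPathTo (l.foldl (fun _ e => E.rng e) x) l := by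
  induction l generalizing x with
  | nil => simp
  | cons e l ih =>
    rw [List.isChain_cons] at hc
    have h := ih (E.rng e) (fun f hf => (hc.1 f hf).symm) hc.2
    refine ⟨hs e rfl, ?_⟩
    simpa using h

theorem isPathTo_range (p : E.Path) : E.IsPathTo p.range p.edges :=
  (foldl_isPathTo p.source p.edges p.source_eq p.chain).2

theorem headVertex_range (p : E.Path) : E.headVertex p.range p.edges = p.source :=
  (foldl_isPathTo p.source p.edges p.source_eq p.chain).1

/-- The range is needed only for length zero, where the list of edges does not see the vertex. -/
theorem eq_of_edges_eq {p q : E.Path} (h : p.edges = q.edges) (hr : p.range = q.range) :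
    p = q := by
  ext1
  · rw [← headVertex_range p, ← headVertex_range q, h, hr]
  · exact h

end Path

end DirGraph

/-! ### A module of functionals over the Leavitt path algebra. -/

namespace LeavittPathAlgebra

open Leavitt

variable {V : Type u} {Ed : Type v} {K : Type w} [Field K] {E : DirGraph V Ed}
variable {R : Type*} [AddCommGroup R] [Module K R]

/-- Functionals on the unitization of the path algebra of the double graph: the first component
is the value at `1`, and `F.2 m p q` is the value at `p q*`, where `p` lists its edges
backwards and `m` is the common range. -/
abbrev Functional (V : Type u) (Ed : Type v) (R : Type*) : Type _ :=
  R × (V → List Ed → List Ed → R)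

open Classical in
variable (K E R) in
/-- The functional `y ↦ F (y x)` for a vertex `x`. -/
noncomputable def vertexAct (x : V) : Module.End K (Functional V Ed R) where
  toFun F := (F.2 x [] [], fun m p q => if E.headVertex m q = x then F.2 m p q else 0)
  map_add' F G := by
    ext
    · rfl
    · simp only [Prod.snd_add, Pi.add_apply]; split_ifs <;> simp
  map_smul' k F := by
    ext
    · rfl
    · simp only [Prod.smul_snd, Pi.smul_apply, RingHom.id_apply]; split_ifs <;> simp

open Classical in
variable (K E R) in
/-- The functional `y ↦ F (y e)` for an edge `e`. -/
noncomputable def edgeAct (e : Ed) : Module.End K (Functional V Ed R) where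
  toFun F := (F.2 (E.rng e) [e] [], fun m p q => match q with
    | [] => if E.src e = m then F.2 (E.rng e) (e :: p) [] else 0
    | f :: q => if f = e ∧ E.headVertex m q = E.rng e then F.2 m p q else 0)
  map_add' F G := by
    ext m p q
    · rfl
    · cases q <;> simp only [Prod.snd_add, Pi.add_apply] <;> split_ifs <;> simp
  map_smul' k F := by
    ext m p q
    · rfl
    · cases q <;> simp only [Prod.smul_snd, Pi.smul_apply, RingHom.id_apply] <;>
        split_ifs <;> simp

open Classical in
variable (K E R) in
/-- The functional `y ↦ F (y e*)` for an edge `e`. -/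
noncomputable def ghostAct (e : Ed) : Module.End K (Functional V Ed R) where
  toFun F := (F.2 (E.rng e) [] [e],
    fun m p q => if E.headVertex m q = E.rng e then F.2 m p (e :: q) else 0)
  map_add' F G := by
    ext
    · rfl
    · simp only [Prod.snd_add, Pi.add_apply]; split_ifs <;> simp
  map_smul' k F := by
    ext
    · rfl
    · simp only [Prod.smul_snd, Pi.smul_apply, RingHom.id_apply]; split_ifs <;> simp

section apply

variable (F : Functional V Ed R) (x m : V) (e f : Ed) (p q : List Ed)

open Classical in
theorem vertexAct_snd : (vertexAct K E R x F).2 m p q =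
    if E.headVertex m q = x then F.2 m p q else 0 := rfl

open Classical in
theorem edgeAct_snd_nil : (edgeAct K E R e F).2 m p [] =
    if E.src e = m then F.2 (E.rng e) (e :: p) [] else 0 := rfl

open Classical in
theorem edgeAct_snd_cons : (edgeAct K E R e F).2 m p (f :: q) =
    if f = e ∧ E.headVertex m q = E.rng e then F.2 m p q else 0 := rfl

open Classical in
theorem ghostAct_snd : (ghostAct K E R e F).2 m p q =
    if E.headVertex m q = E.rng e then F.2 m p (e :: q) else 0 := rfl

end apply

variable (K E R) in
/-- The functionals that descend to the Leavitt path algebra. -/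
def leavittFunctionals : Submodule K (Functional V Ed R) where
  -- Only `q` is tested for being a path: right multiplication strips edges from or adds edges to
  -- the source end of `q`, whereas it only lengthens `p` at its range, where the edge action tests
  -- composability. The second condition is `F(p q*) = ∑ F(p e e* q*)`, that is, (CK2) inserted at
  -- the common range.
  carrier := {F | (∀ m p q, ¬ E.IsPathTo m q → F.2 m p q = 0) ∧
    ∀ m p q (I : Finset Ed), I.Nonempty → (∀ e, e ∈ I ↔ E.src e = m) →
      F.2 m p q = ∑ e ∈ I, F.2 (E.rng e) (e :: p) (q ++ [e])}
  add_mem' {F G} hF hG := by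
    refine ⟨fun m p q h => ?_, fun m p q I h1 h2 => ?_⟩
    · simp [hF.1 m p q h, hG.1 m p q h]
    · simp [hF.2 m p q I h1 h2, hG.2 m p q I h1 h2, Finset.sum_add_distrib]
  zero_mem' := ⟨fun _ _ _ _ => rfl, fun m p q I _ _ => by simp⟩
  smul_mem' k F hF := by
    refine ⟨fun m p q h => ?_, fun m p q I h1 h2 => ?_⟩
    · simp [hF.1 m p q h]
    · simp [hF.2 m p q I h1 h2, Finset.smul_sum]

theorem vertexAct_mem (x : V) {F : Functional V Ed R} (hF : F ∈ leavittFunctionals K E R) :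
    vertexAct K E R x F ∈ leavittFunctionals K E R := by
  refine ⟨fun m p q h => ?_, fun m p q I h1 h2 => ?_⟩
  · simp [vertexAct_snd, hF.1 m p q h]
  · rw [vertexAct_snd, hF.2 m p q I h1 h2]
    split_ifs with h
    · exact Finset.sum_congr rfl fun e he => by
        rw [vertexAct_snd, DirGraph.headVertex_append_singleton, (h2 e).1 he, if_pos h]
    · exact (Finset.sum_eq_zero fun e he => by
        rw [vertexAct_snd, DirGraph.headVertex_append_singleton, (h2 e).1 he, if_neg h]).symm

theorem ghostAct_mem (g : Ed) {F : Functional V Ed R} (hF : F ∈ leavittFunctionals K E R) :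
    ghostAct K E R g F ∈ leavittFunctionals K E R := by
  refine ⟨fun m p q h => ?_, fun m p q I h1 h2 => ?_⟩
  · rw [ghostAct_snd, hF.1 m p (g :: q) (fun h' => h h'.2), ite_self]
  · rw [ghostAct_snd, hF.2 m p (g :: q) I h1 h2]
    split_ifs with h
    · exact Finset.sum_congr rfl fun e he => by
        rw [ghostAct_snd, DirGraph.headVertex_append_singleton, (h2 e).1 he, if_pos h]; rfl
    · exact (Finset.sum_eq_zero fun e he => by
        rw [ghostAct_snd, DirGraph.headVertex_append_singleton, (h2 e).1 he, if_neg h]).symm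

theorem edgeAct_mem (g : Ed) {F : Functional V Ed R} (hF : F ∈ leavittFunctionals K E R) :
    edgeAct K E R g F ∈ leavittFunctionals K E R := by
  classical
  refine ⟨fun m p q h => ?_, fun m p q I h1 h2 => ?_⟩
  · cases q with
    | nil => exact absurd trivial h
    | cons f q =>
      rw [edgeAct_snd_cons]
      split_ifs with h'
      · exact hF.1 m p q fun hq => h ⟨h'.1 ▸ h'.2, hq⟩
      · rfl
  · cases q with
    | nil =>
      -- Here (CK2) for `F` is not what is needed: in `∑ F(p e e* g)` the relation `e*g = 0` for `e
      -- ≠ g` leaves just `F(p g)`.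
      simp only [edgeAct_snd_nil, List.nil_append, edgeAct_snd_cons, DirGraph.headVertex_nil]
      have : ∀ e ∈ I, (if e = g ∧ E.rng e = E.rng g then F.2 (E.rng e) (e :: p) [] else 0) =
          if e = g then F.2 (E.rng e) (e :: p) [] else 0 := fun e _ => by
        by_cases h : e = g <;> simp [h]
      refine Eq.trans ?_ (Finset.sum_congr rfl fun e he => (this e he).symm).symm.symm
      rw [Finset.sum_ite_eq']
      simp [h2]
    | cons f q =>
      simp only [edgeAct_snd_cons, List.cons_append, DirGraph.headVertex_append_singleton]
      rw [hF.2 m p q I h1 h2]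
      split_ifs with h
      · exact Finset.sum_congr rfl fun e he => by rw [(h2 e).1 he, if_pos h]
      · exact (Finset.sum_eq_zero fun e he => by rw [(h2 e).1 he, if_neg h]).symm

variable (K E R) in
/-- The action of formal expressions on functionals. -/
noncomputable def preAct : Pre K V Ed → Module.End K (leavittFunctionals K E R)
  | .vertex x => (vertexAct K E R x).restrict fun _ h => vertexAct_mem x h
  | .edge e => (edgeAct K E R e).restrict fun _ h => edgeAct_mem e h
  | .ghost e => (ghostAct K E R e).restrict fun _ h => ghostAct_mem e h
  | .zero => 0
  | .add a b => preAct a + preAct b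
  | .mul a b => preAct a * preAct b
  | .smul k a => k • preAct a

theorem preAct_sumProj (l : List Ed) :
    preAct K E R (Pre.sumProj l) =
      (l.map fun e => preAct K E R (.edge e) * preAct K E R (.ghost e)).sum := by
  induction l with
  | nil => rfl
  | cons e l ih => rw [List.map_cons, List.sum_cons, ← ih]; rfl

theorem preAct_ext {a b : Module.End K (leavittFunctionals K E R)}
    (h1 : ∀ F, (a F).1.1 = (b F).1.1) (h2 : ∀ F m p q, (a F).1.2 m p q = (b F).1.2 m p q) :
    a = b :=
  LinearMap.ext fun F => Subtype.ext <| Prod.ext (h1 F) <| by ext m p q; exact h2 F m p q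

/-- When the ghost part is empty, this is the summation condition on `F`. When it begins with `f`,
the identity `f*ee* = δ_{e,f} f*` collapses the sum, and the vanishing of `F` off genuine paths
takes care of lists that do not compose. -/
theorem preAct_ck2 (x : V) (l : List Ed) (h1 : l.Nodup) (h2 : l ≠ [])
    (h3 : ∀ e, e ∈ l ↔ E.src e = x) :
    preAct K E R (.vertex x) = preAct K E R (Pre.sumProj l) := by
  classical
  rw [preAct_sumProj, ← List.sum_toFinset _ h1]
  have hI : l.toFinset.Nonempty := by simpa using h2
  have hm : ∀ e, e ∈ l.toFinset ↔ E.src e = x := by simpa using h3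
  generalize l.toFinset = I at hI hm
  refine preAct_ext (fun F => ?_) fun F m p q => ?_
  · simp only [LinearMap.sum_apply, Submodule.coe_sum, Prod.fst_sum]
    change F.1.2 x [] [] = ∑ e ∈ I, (ghostAct K E R e F.1).2 (E.rng e) [e] []
    simpa [ghostAct_snd] using F.2.2 x [] [] I hI hm
  · simp only [LinearMap.sum_apply, Submodule.coe_sum, Prod.snd_sum, Finset.sum_apply]
    change (vertexAct K E R x F.1).2 m p q =
      ∑ e ∈ I, (edgeAct K E R e (ghostAct K E R e F.1)).2 m p q
    cases q with
    | nil =>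
      rw [vertexAct_snd, DirGraph.headVertex_nil]
      split_ifs with h
      · subst h
        rw [F.2.2 m p [] I hI hm]
        exact Finset.sum_congr rfl fun e he => by
          rw [edgeAct_snd_nil, if_pos ((hm e).1 he), ghostAct_snd, if_pos (E.headVertex_nil _)]; rfl
      · exact (Finset.sum_eq_zero fun e he => by
          rw [edgeAct_snd_nil, (hm e).1 he, if_neg (fun h' => h h'.symm)]).symm
    | cons f q =>
      simp only [vertexAct_snd, edgeAct_snd_cons, ghostAct_snd, DirGraph.headVertex_cons]
      have : ∀ e ∈ I, (if f = e ∧ E.headVertex m q = E.rng e then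
          if E.headVertex m q = E.rng e then F.1.2 m p (e :: q) else 0 else 0) =
          if f = e then F.1.2 m p (f :: q) else 0 := fun e _ => by
        by_cases h : f = e
        · subst h
          by_cases h' : E.headVertex m q = E.rng f
          · simp [h']
          · simp [h', F.2.1 m p (f :: q) fun h'' => h' h''.1]
        · simp [h]
      rw [Finset.sum_congr rfl this, Finset.sum_ite_eq]
      exact if_congr (hm f).symm rfl rfl

theorem preAct_rel {a b : Pre K V Ed} (h : Rel K E a b) : preAct K E R a = preAct K E R b := by
  induction h with
  | symm _ ih => exact ih.symm
  | add_congr_left c _ ih => simp only [preAct, ih]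
  | add_congr_right c _ ih => simp only [preAct, ih]
  | mul_congr_left c _ ih => simp only [preAct, ih]
  | mul_congr_right c _ ih => simp only [preAct, ih]
  | smul_congr k _ ih => simp only [preAct, ih]
  | add_assoc a b c => simp only [preAct, _root_.add_assoc]
  | add_comm a b => exact _root_.add_comm _ _
  | zero_add a => exact _root_.zero_add _
  | mul_assoc a b c => simp only [preAct, _root_.mul_assoc]
  | add_mul a b c => exact _root_.add_mul _ _ _
  | mul_add a b c => exact _root_.mul_add _ _ _
  | one_smul a => exact _root_.one_smul _ _
  | zero_smul a => exact _root_.zero_smul _ _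
  | mul_smul k l a => exact SemigroupAction.mul_smul _ _ _
  | add_smul k l a => exact _root_.add_smul _ _ _
  | smul_add k a b => exact _root_.smul_add _ _ _
  | smul_mul k a b => exact smul_mul_assoc _ _ _
  | mul_smul_comm k a b => exact _root_.mul_smul_comm _ _ _
  | v_self x =>
    refine preAct_ext (fun F => ?_) fun F m p q => ?_
    · change (vertexAct K E R x F.1).2 x [] [] = F.1.2 x [] []
      simp [vertexAct_snd]
    · change (vertexAct K E R x (vertexAct K E R x F.1)).2 m p q = (vertexAct K E R x F.1).2 m p q
      simp only [vertexAct_snd]; split_ifs <;> rfl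
  | v_ne x y h =>
    refine preAct_ext (fun F => ?_) fun F m p q => ?_
    · change (vertexAct K E R y F.1).2 x [] [] = 0
      simp [vertexAct_snd, h]
    · change (vertexAct K E R x (vertexAct K E R y F.1)).2 m p q = 0
      simp only [vertexAct_snd]; split_ifs <;> simp_all
  | e1_left e =>
    refine preAct_ext (fun F => ?_) fun F m p q => ?_
    · change (edgeAct K E R e F.1).2 (E.src e) [] [] = F.1.2 (E.rng e) [e] []
      simp [edgeAct_snd_nil]
    · change (vertexAct K E R (E.src e) (edgeAct K E R e F.1)).2 m p q =
        (edgeAct K E R e F.1).2 m p q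
      cases q <;> simp only [vertexAct_snd, edgeAct_snd_nil, edgeAct_snd_cons] <;>
        split_ifs <;> simp_all
  | e1_right e =>
    refine preAct_ext (fun F => ?_) fun F m p q => ?_
    · change (vertexAct K E R (E.rng e) F.1).2 (E.rng e) [e] [] = F.1.2 (E.rng e) [e] []
      simp [vertexAct_snd]
    · change (edgeAct K E R e (vertexAct K E R (E.rng e) F.1)).2 m p q =
        (edgeAct K E R e F.1).2 m p q
      cases q <;> simp only [vertexAct_snd, edgeAct_snd_nil, edgeAct_snd_cons] <;>
        split_ifs <;> simp_all
  | e2_left e =>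
    refine preAct_ext (fun F => ?_) fun F m p q => ?_
    · change (ghostAct K E R e F.1).2 (E.rng e) [] [] = F.1.2 (E.rng e) [] [e]
      simp [ghostAct_snd]
    · change (vertexAct K E R (E.rng e) (ghostAct K E R e F.1)).2 m p q =
        (ghostAct K E R e F.1).2 m p q
      simp only [vertexAct_snd, ghostAct_snd]; split_ifs <;> rfl
  | e2_right e =>
    refine preAct_ext (fun F => ?_) fun F m p q => ?_
    · change (vertexAct K E R (E.src e) F.1).2 (E.rng e) [] [e] = F.1.2 (E.rng e) [] [e]
      simp [vertexAct_snd]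
    · change (ghostAct K E R e (vertexAct K E R (E.src e) F.1)).2 m p q =
        (ghostAct K E R e F.1).2 m p q
      simp [vertexAct_snd, ghostAct_snd]
  | ck1_self e =>
    refine preAct_ext (fun F => ?_) fun F m p q => ?_
    · change (edgeAct K E R e F.1).2 (E.rng e) [] [e] = F.1.2 (E.rng e) [] []
      simp [edgeAct_snd_cons]
    · change (ghostAct K E R e (edgeAct K E R e F.1)).2 m p q =
        (vertexAct K E R (E.rng e) F.1).2 m p q
      simp only [vertexAct_snd, ghostAct_snd, edgeAct_snd_cons]; split_ifs <;> simp_all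
  | ck1_ne e f h =>
    refine preAct_ext (fun F => ?_) fun F m p q => ?_
    · change (edgeAct K E R f F.1).2 (E.rng e) [] [e] = 0
      simp [edgeAct_snd_cons, h]
    · change (ghostAct K E R e (edgeAct K E R f F.1)).2 m p q = 0
      simp [ghostAct_snd, edgeAct_snd_cons, h]
  | ck2 x l h1 h2 h3 => exact preAct_ck2 x l h1 h2 h3

variable (K E R) in
/-- The action of the Leavitt path algebra on functionals. -/
noncomputable def act : LeavittPathAlgebra K E → Module.End K (leavittFunctionals K E R) :=
  Quot.lift (preAct K E R) fun _ _ h => preAct_rel h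

theorem act_mul (x y : LeavittPathAlgebra K E) : act K E R (x * y) = act K E R x * act K E R y := by
  induction x using Quot.ind with | _ a =>
  induction y using Quot.ind with | _ b => rfl

/-- The linear map on the Leavitt path algebra given by a functional. -/
noncomputable def ofFunctional (F : leavittFunctionals K E R) :
    LeavittPathAlgebra K E →ₗ[K] R where
  toFun x := (act K E R x F).1.1
  map_add' x y := by
    induction x using Quot.ind with | _ a =>
    induction y using Quot.ind with | _ b => rfl
  map_smul' k x := by
    induction x using Quot.ind with | _ a => rfl

theorem ofFunctional_vertex (F : leavittFunctionals K E R) (x : V) :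
    ofFunctional F (vertex K E x) = F.1.2 x [] [] := rfl

/-- The hypothesis `ha` says that `a` is evaluated as the path stored backwards in `p` and ending at
`m`. Each further edge is pushed onto the front of `p`, whence the reversal. -/
theorem act_foldl_edge (l : List Ed) (a : LeavittPathAlgebra K E) (m : V) (p : List Ed)
    (ha : ∀ F, (act K E R a F).1.1 = F.1.2 m p [])
    (hs : ∀ e ∈ l.head?, E.src e = m) (hc : l.IsChain (fun e f => E.rng e = E.src f))
    (F : leavittFunctionals K E R) :
    (act K E R (l.foldl (fun a e => a * edge K E e) a) F).1.1 =
      F.1.2 (l.foldl (fun _ e => E.rng e) m) (l.reverse ++ p) [] := by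
  induction l generalizing a m p with
  | nil => exact ha F
  | cons e l ih =>
    rw [List.isChain_cons] at hc
    rw [List.foldl_cons, ih _ (E.rng e) (e :: p) (fun F => ?_) (fun f hf => (hc.1 f hf).symm) hc.2]
    · simp
    · rw [act_mul]
      change (act K E R a _).1.1 = _
      rw [ha]
      change (edgeAct K E R e F.1).2 m p [] = _
      rw [edgeAct_snd_nil, if_pos (hs e rfl)]

theorem act_foldl_ghost (l : List Ed) (a : LeavittPathAlgebra K E) (m : V) (p q : List Ed)
    (h : E.IsPathTo m (l.reverse ++ q)) (F : leavittFunctionals K E R) : 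
    (act K E R (l.foldr (fun e a => ghost K E e * a) a) F).1.2 m p q =
      (act K E R a F).1.2 m p (l.reverse ++ q) := by
  induction l generalizing q with
  | nil => rfl
  | cons e l ih =>
    have h' : E.IsPathTo m (l.reverse ++ e :: q) := by simpa using h
    have hq : ∀ l' : List Ed, E.IsPathTo m (l' ++ e :: q) → E.headVertex m q = E.rng e := by
      intro l'
      induction l' with
      | nil => exact fun h => h.1
      | cons f l' ih => exact fun h => ih h.2
    rw [List.foldr_cons, act_mul]
    change (ghostAct K E R e (act K E R _ F).1).2 m p q = _
    rw [ghostAct_snd, if_pos (hq _ h'), ih _ h']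
    simp

/-- Evaluation recovers the table entry. Equal ranges are required because one vertex `m` labels the
range of both paths. -/
theorem ofFunctional_path_mul_ghostPath (F : leavittFunctionals K E R) (p q : E.Path)
    (h : p.range = q.range) :
    ofFunctional F (path K p * ghostPath K q) = F.1.2 p.range p.edges.reverse q.edges := by
  change (act K E R (path K p * ghostPath K q) F).1.1 = _
  rw [act_mul]
  change (act K E R (path K p) _).1.1 = _
  rw [path, act_foldl_edge (m := p.source) (p := []) _ _ (fun _ => rfl) p.source_eq p.chain,
    ghostPath, ← List.foldr_reverse, act_foldl_ghost]
  · change (vertexAct K E R _ F.1).2 _ _ _ = _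
    change (vertexAct K E R _ F.1).2 p.range _ _ = _
    rw [vertexAct_snd, if_pos (by simpa [h] using q.headVertex_range)]
    simp
  · change E.IsPathTo p.range _
    rw [h]
    simpa using q.isPathTo_range

/-- Select one outgoing edge at every vertex that emits edges, and let `F(p q*)` be `1` when `q` is
a path and all edges of `p` and `q` are selected, and `0` otherwise. In each (CK2) sum only the
selected edge contributes, so `F` descends, and it takes the value `1` at every vertex. -/
theorem vertex_ne_zero (x : V) : vertex K E x ≠ 0 := by
  classical
  -- The choice depends on `e` only through its source, so edges with a common source share the same
  -- selected edge.
  let D : Ed → Prop := fun e => ∃ h : ∃ f, E.src f = E.src e, h.choose = e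
  have key : ((0 : K), fun (m : V) (p q : List Ed) =>
      if E.IsPathTo m q ∧ (∀ e ∈ p, D e) ∧ ∀ e ∈ q, D e then (1 : K) else 0) ∈
      leavittFunctionals K E K := by
    refine ⟨fun m p q h => if_neg fun h' => h h'.1, fun m p q I hI hm => ?_⟩
    obtain ⟨e₀, he₀⟩ := hI
    have hex : ∃ f, E.src f = m := ⟨e₀, (hm e₀).1 he₀⟩
    have hD : ∀ e ∈ I, (D e ↔ e = hex.choose) := fun e he => by
      have := (hm e).1 he
      subst this
      exact ⟨fun ⟨_, h⟩ => h.symm, fun h => ⟨hex, h.symm⟩⟩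
    have hterm : ∀ e ∈ I, (if E.IsPathTo (E.rng e) (q ++ [e]) ∧ (∀ f ∈ e :: p, D f) ∧
        (∀ f ∈ q ++ [e], D f) then (1 : K) else 0) = if e = hex.choose then
        (if E.IsPathTo m q ∧ (∀ e ∈ p, D e) ∧ (∀ e ∈ q, D e) then (1 : K) else 0) else 0 := by
      intro e he
      rw [← ite_and]
      congr 1
      rw [← hD e he, DirGraph.isPathTo_append_singleton, (hm e).1 he]
      simp only [List.mem_cons, List.mem_append, List.not_mem_nil, or_false, or_imp, forall_and,
        forall_eq]
      exact propext (by tauto)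
    refine Eq.trans ?_ (Finset.sum_congr rfl hterm).symm
    rw [Finset.sum_ite_eq', if_pos ((hm _).2 hex.choose_spec)]
  intro h
  have h1 := ofFunctional_vertex ⟨_, key⟩ x
  rw [h, map_zero] at h1
  simp at h1

end LeavittPathAlgebra

/-! ### Positive elements of involutive rings. -/

section Positive

variable {R : Type*} [NonUnitalRing R] [StarRing R]

theorem isPosElt_zero : IsPosElt (0 : R) := ⟨0, Fin.elim0, by simp⟩

theorem isPosElt_mul_star (y : R) : IsPosElt (y * star y) := ⟨1, fun _ => y, by simp⟩

theorem IsPosElt.add {x y : R} (hx : IsPosElt x) (hy : IsPosElt y) : IsPosElt (x + y) := by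
  obtain ⟨m, a, rfl⟩ := hx
  obtain ⟨n, b, rfl⟩ := hy
  exact ⟨m + n, Fin.append a b, by simp [Fin.sum_univ_add]⟩

theorem IsPosElt.sum {ι : Type*} {s : Finset ι} {f : ι → R} (h : ∀ i ∈ s, IsPosElt (f i)) :
    IsPosElt (∑ i ∈ s, f i) := by
  classical
  induction s using Finset.induction_on with
  | empty => simpa using isPosElt_zero
  | insert a s ha ih =>
    rw [Finset.sum_insert ha]
    exact (h a (by simp)).add (ih fun i hi => h i (by simp [hi]))

theorem IsPosElt.smul {K : Type*} [Field K] [StarRing K] [Module K R] [IsScalarTower K R R]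
    [SMulCommClass K R R] [StarModule K R] (c : K) {x : R} (hx : IsPosElt x) :
    IsPosElt ((c * star c) • x) := by
  obtain ⟨n, a, rfl⟩ := hx
  refine ⟨n, fun i => c • a i, ?_⟩
  rw [Finset.smul_sum]
  refine Finset.sum_congr rfl fun i _ => ?_
  rw [star_smul, smul_mul_smul_comm]

/-- Positive definiteness is applied to the concatenation of the two families of summands: positive
elements cannot cancel. -/
theorem IsPosDefStarRing.eq_zero_of_add_eq_zero (hR : IsPosDefStarRing R) {x y : R}
    (hx : IsPosElt x) (hy : IsPosElt y) (h : x + y = 0) : x = 0 := by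
  obtain ⟨m, a, rfl⟩ := hx
  obtain ⟨n, b, rfl⟩ := hy
  have := hR (m + n) (Fin.append a b) (by simpa [Fin.sum_univ_add] using h)
  refine Finset.sum_eq_zero fun i _ => ?_
  have hi : a i = 0 := by simpa using this (Fin.castAdd n i)
  rw [hi, zero_mul]

theorem IsPosDefStarRing.eq_zero_of_sum_eq_zero (hR : IsPosDefStarRing R) {ι : Type*}
    {s : Finset ι} {f : ι → R} (hf : ∀ i ∈ s, IsPosElt (f i)) (h : ∑ i ∈ s, f i = 0) :
    ∀ i ∈ s, f i = 0 := by
  classical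
  intro i hi
  rw [← Finset.add_sum_erase s f hi] at h
  exact hR.eq_zero_of_add_eq_zero (hf i hi)
    (IsPosElt.sum fun j hj => hf j (Finset.mem_of_mem_erase hj)) h

end Positive

/-! ### Extending paths at either end. -/

namespace DirGraph.Path

variable {V : Type u} {Ed : Type v} {E : DirGraph V Ed}

variable (E) in
/-- The path of length zero at `x`. -/
def nil (x : V) : E.Path := ⟨x, [], by simp, by simp⟩

/-- The path `e p`. -/
def cons (e : Ed) (p : E.Path) (h : E.rng e = p.source) : E.Path where
  source := E.src e
  edges := e :: p.edges
  source_eq := by simp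
  chain := List.isChain_cons.2 ⟨fun f hf => h.trans (p.source_eq f hf).symm, p.chain⟩

theorem cons_induction {motive : E.Path → Prop} (nil : ∀ x, motive (nil E x))
    (cons : ∀ e p h, motive p → motive (cons e p h)) (p : E.Path) : motive p := by
  obtain ⟨s, l, hs, hc⟩ := p
  induction l generalizing s with
  | nil => exact nil s
  | cons e l ih =>
    obtain rfl := hs e rfl
    rw [List.isChain_cons] at hc
    exact cons e ⟨E.rng e, l, fun f hf => (hc.1 f hf).symm, hc.2⟩ rfl (ih _ _ _)

theorem foldl_range_of_isChain (x : V) (l : List Ed) :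
    ∀ e ∈ l.getLast?, E.rng e = l.foldl (fun _ e => E.rng e) x := by
  induction l using List.reverseRecOn <;> simp

/-- The path `p e`. -/
def snoc (p : E.Path) (e : Ed) (h : E.src e = p.range) : E.Path where
  source := p.source
  edges := p.edges ++ [e]
  source_eq := by
    obtain ⟨s, l, hs, hc⟩ := p
    cases l with
    | nil => simpa [Path.range] using h
    | cons f l => simpa using hs
  chain := List.isChain_append.2 ⟨p.chain, by simp, fun f hf g hg => by
    obtain rfl : e = g := by simpa using hg
    rw [h, foldl_range_of_isChain p.source p.edges f hf, Path.range]⟩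

@[simp] theorem range_cons (e : Ed) (p : E.Path) (h : E.rng e = p.source) :
    (cons e p h).range = p.range := by
  simp [Path.range, cons, h]

@[simp] theorem range_snoc (p : E.Path) (e : Ed) (h : E.src e = p.range) :
    (snoc p e h).range = E.rng e := by
  simp [Path.range, snoc]

theorem snoc_inj {p q : E.Path} {e : Ed} {hp : E.src e = p.range} {hq : E.src e = q.range} :
    snoc p e hp = snoc q e hq ↔ p = q := by
  refine ⟨fun h => ?_, by rintro rfl; rfl⟩
  have h1 := congrArg Path.edges h
  exact eq_of_edges_eq (by simpa [snoc] using h1) (hp.symm.trans hq)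

theorem cons_inj {p q : E.Path} {e f : Ed} {hp : E.rng e = p.source} {hq : E.rng f = q.source} :
    cons e p hp = cons f q hq ↔ e = f ∧ p = q := by
  refine ⟨fun h => ?_, by rintro ⟨rfl, rfl⟩; rfl⟩
  have h1 : e = f ∧ p.edges = q.edges := by simpa [cons] using congrArg Path.edges h
  refine ⟨h1.1, ?_⟩
  ext1
  · rw [← hp, ← hq, h1.1]
  · exact h1.2

end DirGraph.Path

/-! ### Multiplication rules and the spanning monomials. -/

namespace LeavittPathAlgebra

open Leavitt DirGraph

variable {V : Type u} {Ed : Type v} {K : Type w} [Field K] {E : DirGraph V Ed}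

theorem generator_induction {motive : LeavittPathAlgebra K E → Prop}
    (vertex : ∀ x, motive (vertex K E x)) (edge : ∀ e, motive (edge K E e))
    (ghost : ∀ e, motive (ghost K E e)) (zero : motive 0)
    (add : ∀ x y, motive x → motive y → motive (x + y))
    (mul : ∀ x y, motive x → motive y → motive (x * y))
    (smul : ∀ (k : K) x, motive x → motive (k • x)) (x : LeavittPathAlgebra K E) : motive x := by
  induction x using Quot.ind with | _ a =>
  induction a with
  | vertex x => exact vertex x
  | edge e => exact edge e
  | ghost e => exact ghost e
  | zero => exact zero
  | add a b ha hb => exact add _ _ ha hb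
  | mul a b ha hb => exact mul _ _ ha hb
  | smul k a ha => exact smul k _ ha

theorem vertex_mul_self (x : V) : vertex K E x * vertex K E x = vertex K E x :=
  Quot.sound (.v_self x)

theorem vertex_mul_of_ne {x y : V} (h : x ≠ y) : vertex K E x * vertex K E y = 0 :=
  Quot.sound (.v_ne x y h)

theorem src_mul_edge (e : Ed) : vertex K E (E.src e) * edge K E e = edge K E e :=
  Quot.sound (.e1_left e)

theorem edge_mul_rng (e : Ed) : edge K E e * vertex K E (E.rng e) = edge K E e :=
  Quot.sound (.e1_right e)

theorem rng_mul_ghost (e : Ed) : vertex K E (E.rng e) * ghost K E e = ghost K E e :=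
  Quot.sound (.e2_left e)

theorem ghost_mul_src (e : Ed) : ghost K E e * vertex K E (E.src e) = ghost K E e :=
  Quot.sound (.e2_right e)

theorem ghost_mul_edge_self (e : Ed) : ghost K E e * edge K E e = vertex K E (E.rng e) :=
  Quot.sound (.ck1_self e)

theorem ghost_mul_edge_of_ne {e f : Ed} (h : e ≠ f) : ghost K E e * edge K E f = 0 :=
  Quot.sound (.ck1_ne e f h)

theorem vertex_eq_sum (x : V) (I : Finset Ed) (hI : I.Nonempty) (h : ∀ e, e ∈ I ↔ E.src e = x) :
    vertex K E x = ∑ e ∈ I, edge K E e * ghost K E e := by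
  have h1 : vertex K E x = Quot.mk _ (Pre.sumProj I.toList) :=
    Quot.sound (.ck2 x _ I.nodup_toList (by simpa using hI.ne_empty) (by simpa using h))
  rw [h1, ← Finset.sum_map_toList]
  induction I.toList with
  | nil => rfl
  | cons e l ih => rw [List.map_cons, List.sum_cons, ← ih]; rfl

theorem vertex_mul_edge_of_ne {x : V} {e : Ed} (h : x ≠ E.src e) :
    vertex K E x * edge K E e = 0 := by
  rw [← src_mul_edge, ← mul_assoc, vertex_mul_of_ne h, zero_mul]

theorem ghost_mul_vertex_of_ne {x : V} {e : Ed} (h : E.src e ≠ x) :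
    ghost K E e * vertex K E x = 0 := by
  rw [← ghost_mul_src, mul_assoc, vertex_mul_of_ne h, mul_zero]

theorem foldl_mul_edge (a b : LeavittPathAlgebra K E) (l : List Ed) :
    l.foldl (fun a e => a * edge K E e) (a * b) = a * l.foldl (fun a e => a * edge K E e) b := by
  induction l generalizing b with
  | nil => rfl
  | cons e l ih => rw [List.foldl_cons, mul_assoc, ih, List.foldl_cons]

theorem path_cons (e : Ed) (p : E.Path) (h : E.rng e = p.source) :
    path K (p.cons e h) = edge K E e * path K p := by
  change p.edges.foldl _ (vertex K E (E.src e) * edge K E e) = _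
  have h1 : edge K E e * vertex K E p.source = edge K E e := by rw [← h, edge_mul_rng]
  rw [src_mul_edge, ← h1, foldl_mul_edge, h1]; rfl

theorem path_snoc (p : E.Path) (e : Ed) (h : E.src e = p.range) :
    path K (p.snoc e h) = path K p * edge K E e := by
  simp [path, Path.snoc]

theorem vertex_mul_path (p : E.Path) : vertex K E p.source * path K p = path K p := by
  rw [path, ← foldl_mul_edge, vertex_mul_self]

theorem vertex_mul_path_of_ne {x : V} {p : E.Path} (h : x ≠ p.source) :
    vertex K E x * path K p = 0 := by
  rw [← vertex_mul_path, ← mul_assoc, vertex_mul_of_ne h, zero_mul]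

theorem path_mul_vertex (p : E.Path) : path K p * vertex K E p.range = path K p := by
  induction p using Path.cons_induction with
  | nil x => exact vertex_mul_self x
  | cons e p h ih => rw [path_cons, Path.range_cons, mul_assoc, ih]

theorem path_mul_vertex_of_ne {x : V} {p : E.Path} (h : p.range ≠ x) :
    path K p * vertex K E x = 0 := by
  rw [← path_mul_vertex, mul_assoc, vertex_mul_of_ne h, mul_zero]

theorem edge_mul_path_of_ne {e : Ed} {p : E.Path} (h : E.rng e ≠ p.source) :
    edge K E e * path K p = 0 := by
  rw [← edge_mul_rng, mul_assoc, vertex_mul_path_of_ne h, mul_zero]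

theorem path_mul_edge_of_ne {e : Ed} {p : E.Path} (h : E.src e ≠ p.range) :
    path K p * edge K E e = 0 := by
  rw [← src_mul_edge, ← mul_assoc, path_mul_vertex_of_ne h.symm, zero_mul]

theorem ghost_mul_path_cons (e : Ed) (p : E.Path) (h : E.rng e = p.source) :
    ghost K E e * path K (p.cons e h) = path K p := by
  rw [path_cons, ← mul_assoc, ghost_mul_edge_self, h, vertex_mul_path]

theorem ghost_mul_path_cons_of_ne {e f : Ed} (hef : e ≠ f) (p : E.Path)
    (h : E.rng f = p.source) : ghost K E e * path K (p.cons f h) = 0 := by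
  rw [path_cons, ← mul_assoc, ghost_mul_edge_of_ne hef, zero_mul]

variable (K E) in
/-- The set of all products `p q*` of a path and a ghost path, and `0`. -/
def monomials : Set (LeavittPathAlgebra K E) :=
  {x | x = 0 ∨ ∃ p q : E.Path, x = path K p * ghostPath K q}

theorem mul_ghostPath_mem_monomials (q : E.Path) {x : LeavittPathAlgebra K E}
    (hx : x = 0 ∨ ∃ p : E.Path, x = path K p) : x * ghostPath K q ∈ monomials K E := by
  obtain rfl | ⟨p, rfl⟩ := hx
  · exact .inl (zero_mul _)
  · exact .inr ⟨p, q, rfl⟩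

theorem mul_mem_span_of_generator {g : LeavittPathAlgebra K E}
    (hg : ∀ y ∈ monomials K E, g * y ∈ monomials K E) {y : LeavittPathAlgebra K E}
    (hy : y ∈ Submodule.span K (monomials K E)) :
    g * y ∈ Submodule.span K (monomials K E) := by
  have : Submodule.span K (monomials K E) ≤
      (Submodule.span K (monomials K E)).comap (LinearMap.mulLeft K g) :=
    Submodule.span_le.2 fun y hy => Submodule.subset_span (hg y hy)
  exact this hy

theorem vertex_mem_monomials (x : V) : vertex K E x ∈ monomials K E :=
  .inr ⟨Path.nil E x, Path.nil E x, (vertex_mul_self x).symm⟩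

theorem vertex_mul_mem_monomials (x : V) {y : LeavittPathAlgebra K E}
    (hy : y ∈ monomials K E) : vertex K E x * y ∈ monomials K E := by
  obtain rfl | ⟨p, q, rfl⟩ := hy
  · exact .inl (mul_zero _)
  · rw [← mul_assoc]
    refine mul_ghostPath_mem_monomials q ?_
    by_cases h : x = p.source
    · exact .inr ⟨p, by rw [h, vertex_mul_path]⟩
    · exact .inl (vertex_mul_path_of_ne h)

theorem edge_mul_mem_monomials (e : Ed) {y : LeavittPathAlgebra K E}
    (hy : y ∈ monomials K E) : edge K E e * y ∈ monomials K E := by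
  obtain rfl | ⟨p, q, rfl⟩ := hy
  · exact .inl (mul_zero _)
  · rw [← mul_assoc]
    refine mul_ghostPath_mem_monomials q ?_
    by_cases h : E.rng e = p.source
    · exact .inr ⟨p.cons e h, by rw [path_cons]⟩
    · exact .inl (edge_mul_path_of_ne h)

open Classical in
variable (E) in
/-- The functional `p q* ↦ δ_{p,q} δ(r(p))`. -/
noncomputable def traceFunctional {R : Type*} [AddCommGroup R] (δ : V → R) : Functional V Ed R :=
  (0, fun m p q => if E.IsPathTo m q ∧ p.reverse = q then δ m else 0)

theorem traceFunctional_mem {R : Type*} [NonUnitalRing R] [Module K R] {δ : V → R} (hδ : E.IsGraphTrace δ) :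
    traceFunctional E δ ∈ leavittFunctionals K E R := by
  refine ⟨fun m p q h => if_neg fun h' => h h'.1, fun m p q I hI hm => ?_⟩
  classical
  change (if E.IsPathTo m q ∧ p.reverse = q then δ m else 0) = ∑ e ∈ I,
    if E.IsPathTo (E.rng e) (q ++ [e]) ∧ (e :: p).reverse = q ++ [e] then δ (E.rng e) else 0
  split_ifs with h
  · rw [hδ m I (by ext e; simp [hm]) hI]
    refine Finset.sum_congr rfl fun e he => (if_pos ?_).symm
    simpa [(hm e).1 he] using h
  · refine (Finset.sum_eq_zero fun e he => if_neg fun h' => h ?_).symm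
    simpa [(hm e).1 he] using h'

section star

variable [StarRing K]

@[simp] theorem star_vertex (x : V) : star (vertex K E x) = vertex K E x := rfl

@[simp] theorem star_edge (e : Ed) : star (edge K E e) = ghost K E e := rfl

@[simp] theorem star_ghost (e : Ed) : star (ghost K E e) = edge K E e := rfl

theorem star_foldl_edge (a : LeavittPathAlgebra K E) (l : List Ed) :
    star (l.foldl (fun a e => a * edge K E e) a) =
      l.foldl (fun a e => ghost K E e * a) (star a) := by
  induction l generalizing a with
  | nil => rfl
  | cons e l ih => rw [List.foldl_cons, ih, star_mul, star_edge, List.foldl_cons]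

@[simp] theorem star_path (p : E.Path) : star (path K p) = ghostPath K p :=
  star_foldl_edge _ _

@[simp] theorem star_ghostPath (p : E.Path) : star (ghostPath K p) = path K p := by
  rw [← star_path, star_star]

theorem ghostPath_cons (e : Ed) (p : E.Path) (h : E.rng e = p.source) :
    ghostPath K (p.cons e h) = ghostPath K p * ghost K E e := by
  rw [← star_path, path_cons, star_mul, star_path, star_edge]

theorem path_mul_ghostPath_of_ne {p q : E.Path} (h : p.range ≠ q.range) :
    path K p * ghostPath K q = 0 := by
  rw [← path_mul_vertex, mul_assoc, ← star_path, ← star_vertex, ← star_mul,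
    path_mul_vertex_of_ne h.symm, star_zero, mul_zero]

theorem star_mem_monomials {x : LeavittPathAlgebra K E} (hx : x ∈ monomials K E) :
    star x ∈ monomials K E := by
  obtain rfl | ⟨p, q, rfl⟩ := hx
  · exact .inl (star_zero _)
  · exact .inr ⟨q, p, by simp⟩

theorem ghost_mul_mem_monomials (e : Ed) {y : LeavittPathAlgebra K E}
    (hy : y ∈ monomials K E) : ghost K E e * y ∈ monomials K E := by
  obtain rfl | ⟨p, q, rfl⟩ := hy
  · exact .inl (mul_zero _)
  · induction p using Path.cons_induction with
    | nil x =>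
      change ghost K E e * (vertex K E x * _) ∈ _
      -- With `p` a vertex, the product `e* x q*` is the adjoint of `q x e`, which is a path or
      -- zero.
      rw [← star_star (ghost K E e * _)]
      apply star_mem_monomials
      rw [star_mul, star_mul, star_vertex, star_ghost, star_ghostPath, mul_assoc]
      by_cases hx : x = E.src e
      · rw [hx, src_mul_edge]
        by_cases h : E.src e = q.range
        · refine .inr ⟨q.snoc e h, Path.nil E (E.rng e), ?_⟩
          rw [path_snoc, mul_assoc]
          exact congrArg _ (edge_mul_rng e).symm
        · exact .inl (path_mul_edge_of_ne h)
      · rw [vertex_mul_edge_of_ne hx, mul_zero]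
        exact .inl rfl
    | cons f p h _ =>
      rw [← mul_assoc]
      refine mul_ghostPath_mem_monomials q ?_
      by_cases hef : e = f
      · subst hef
        exact .inr ⟨p, ghost_mul_path_cons e p h⟩
      · exact .inl (ghost_mul_path_cons_of_ne hef p h)

omit [StarRing K] in
theorem edge_mem_monomials (e : Ed) : edge K E e ∈ monomials K E := by
  rw [← edge_mul_rng]; exact edge_mul_mem_monomials e (vertex_mem_monomials _)

theorem ghost_mem_monomials (e : Ed) : ghost K E e ∈ monomials K E :=
  star_mem_monomials (edge_mem_monomials e)

theorem span_monomials : Submodule.span K (monomials K E) = ⊤ := by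
  rw [eq_top_iff]
  rintro x -
  -- Membership alone does not pass to products; stability of the span under left multiplication by
  -- `x` is carried along.
  suffices h : x ∈ Submodule.span K (monomials K E) ∧
      ∀ y ∈ Submodule.span K (monomials K E), x * y ∈ Submodule.span K (monomials K E) from h.1
  induction x using generator_induction with
  | vertex x =>
    exact ⟨Submodule.subset_span (vertex_mem_monomials x), fun y hy =>
      mul_mem_span_of_generator (g := vertex K E x) (fun y => vertex_mul_mem_monomials x) hy⟩
  | edge e =>
    exact ⟨Submodule.subset_span (edge_mem_monomials e), fun y hy =>
      mul_mem_span_of_generator (g := edge K E e) (fun y => edge_mul_mem_monomials e) hy⟩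
  | ghost e =>
    exact ⟨Submodule.subset_span (ghost_mem_monomials e), fun y hy =>
      mul_mem_span_of_generator (g := ghost K E e) (fun y => ghost_mul_mem_monomials e) hy⟩
  | zero =>
    exact ⟨zero_mem _, fun y _ => by rw [zero_mul]; exact zero_mem _⟩
  | add a b ha hb =>
    refine ⟨add_mem ha.1 hb.1, fun y hy => ?_⟩
    rw [add_mul]
    exact add_mem (ha.2 y hy) (hb.2 y hy)
  | mul a b ha hb =>
    refine ⟨ha.2 _ hb.1, fun y hy => ?_⟩
    rw [mul_assoc]
    exact ha.2 _ (hb.2 y hy)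
  | smul k a ha =>
    refine ⟨Submodule.smul_mem _ k ha.1, fun y hy => ?_⟩
    rw [smul_mul_assoc]
    exact Submodule.smul_mem _ k (ha.2 y hy)

/-! ### The canonical trace of a graph trace. -/

section trace

variable {R : Type*} [NonUnitalRing R] [Module K R]

/-- The canonical trace extending a graph trace. -/
noncomputable def canonicalTrace (δ : V → R) (hδ : E.IsGraphTrace δ) :
    LeavittPathAlgebra K E →ₗ[K] R :=
  ofFunctional ⟨traceFunctional E δ, traceFunctional_mem hδ⟩

omit [StarRing K] in
theorem canonicalTrace_vertex (δ : V → R) (hδ : E.IsGraphTrace δ) (x : V) :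
    canonicalTrace δ hδ (vertex K E x) = δ x := by
  rw [canonicalTrace, ofFunctional_vertex]
  exact if_pos ⟨trivial, rfl⟩

open Classical in
theorem canonicalTrace_path_mul_ghostPath (δ : V → R) (hδ : E.IsGraphTrace δ) (p q : E.Path) :
    canonicalTrace δ hδ (path K p * ghostPath K q) = if p = q then δ p.range else 0 := by
  by_cases h : p.range = q.range
  · rw [canonicalTrace, ofFunctional_path_mul_ghostPath _ _ _ h]
    refine if_congr ⟨fun h' => Path.eq_of_edges_eq (by simpa using h'.2) h, ?_⟩ rfl rfl
    rintro rfl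
    exact ⟨p.isPathTo_range, p.edges.reverse_reverse⟩
  · rw [path_mul_ghostPath_of_ne h, map_zero, if_neg]
    rintro rfl
    exact h rfl

theorem canonicalTrace_isCanonical (δ : V → R) (hδ : E.IsGraphTrace δ) :
    IsCanonical (canonicalTrace (K := K) δ hδ) := by
  intro p q
  rw [canonicalTrace_path_mul_ghostPath, canonicalTrace_vertex]
  refine ⟨?_, ?_, rfl⟩
  · by_cases h : p = q <;> simp [h]
  · split_ifs <;> rfl

/-- The value at `p q*` is symmetric in `p` and `q`. The restriction to monomials matters, as the
trace is linear and the involution conjugate-linear. -/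
theorem canonicalTrace_star (δ : V → R) (hδ : E.IsGraphTrace δ) {x : LeavittPathAlgebra K E}
    (hx : x ∈ monomials K E) : canonicalTrace δ hδ (star x) = canonicalTrace δ hδ x := by
  obtain rfl | ⟨p, q, rfl⟩ := hx
  · rw [star_zero]
  · rw [star_mul, star_path, star_ghostPath, canonicalTrace_path_mul_ghostPath,
      canonicalTrace_path_mul_ghostPath]
    by_cases h : p = q
    · rw [h]
    · rw [if_neg h, if_neg (Ne.symm h)]

theorem canonicalTrace_vertex_mul (δ : V → R) (hδ : E.IsGraphTrace δ) (x : V)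
    {y : LeavittPathAlgebra K E} (hy : y ∈ monomials K E) :
    canonicalTrace δ hδ (vertex K E x * y) = canonicalTrace δ hδ (y * vertex K E x) := by
  obtain rfl | ⟨p, q, rfl⟩ := hy
  · rw [zero_mul, mul_zero]
  · have hq : ghostPath K q * vertex K E x = star (vertex K E x * path K q) := by simp
    rw [← mul_assoc, mul_assoc (path K p), hq]
    by_cases hp : x = p.source <;> by_cases hq : x = q.source
    · rw [hq, vertex_mul_path, ← hq, hp, vertex_mul_path, star_path]
    · rw [hp, vertex_mul_path, ← hp, vertex_mul_path_of_ne hq, star_zero, mul_zero, map_zero,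
        canonicalTrace_path_mul_ghostPath, if_neg]
      rintro rfl; exact hq hp
    · rw [hq, vertex_mul_path, ← hq, vertex_mul_path_of_ne hp, zero_mul, map_zero, star_path,
        canonicalTrace_path_mul_ghostPath, if_neg]
      rintro rfl; exact hp hq
    · rw [vertex_mul_path_of_ne hq, vertex_mul_path_of_ne hp, zero_mul, star_zero, mul_zero]

/-- If `q` is a vertex, both sides vanish, since a path containing `e` has positive length. If `q =
f q'`, both sides are nonzero only if `e = f` and `p = q'`, and then they agree because prepending
`e` keeps the range. -/
theorem canonicalTrace_edge_mul (δ : V → R) (hδ : E.IsGraphTrace δ) (e : Ed)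
    {y : LeavittPathAlgebra K E} (hy : y ∈ monomials K E) :
    canonicalTrace δ hδ (edge K E e * y) = canonicalTrace δ hδ (y * edge K E e) := by
  classical
  obtain rfl | ⟨p, q, rfl⟩ := hy
  · rw [zero_mul, mul_zero]
  have hq : ghostPath K q * edge K E e = star (ghost K E e * path K q) := by simp
  have hcons : ∀ h : E.rng e = p.source, canonicalTrace δ hδ (edge K E e * (path K p *
      ghostPath K q)) = canonicalTrace δ hδ (path K (p.cons e h) * ghostPath K q) := fun h => by
    rw [← mul_assoc, path_cons]
  have hzero : E.rng e ≠ p.source → canonicalTrace δ hδ (edge K E e * (path K p *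
      ghostPath K q)) = 0 := fun h => by
    rw [← mul_assoc, edge_mul_path_of_ne h, zero_mul, map_zero]
  induction q using Path.cons_induction with
  | nil x =>
    have hl : canonicalTrace δ hδ (edge K E e * (path K p * ghostPath K (Path.nil E x))) = 0 := by
      by_cases h : E.rng e = p.source
      · rw [hcons h, canonicalTrace_path_mul_ghostPath, if_neg]
        intro h'
        simpa [Path.cons, Path.nil] using congrArg Path.edges h'
      · exact hzero h
    rw [hl, mul_assoc, eq_comm]
    change canonicalTrace δ hδ (path K p * (vertex K E x * edge K E e)) = 0
    by_cases hx : x = E.src e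
    · rw [hx, src_mul_edge]
      by_cases h : E.src e = p.range
      · have := canonicalTrace_path_mul_ghostPath (K := K) δ hδ (p.snoc e h)
          (Path.nil E (E.rng e))
        rw [path_snoc, mul_assoc, if_neg] at this
        · change canonicalTrace δ hδ (path K p * (edge K E e * vertex K E (E.rng e))) = 0 at this
          rwa [edge_mul_rng] at this
        · intro h'
          simpa [Path.snoc, Path.nil] using congrArg Path.edges h'
      · rw [path_mul_edge_of_ne h, map_zero]
    · rw [vertex_mul_edge_of_ne hx, mul_zero, map_zero]
  | cons f q h _ =>
    rw [mul_assoc, hq]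
    by_cases hef : e = f
    · subst hef
      rw [ghost_mul_path_cons, star_path, canonicalTrace_path_mul_ghostPath]
      by_cases hp : E.rng e = p.source
      · rw [hcons hp, canonicalTrace_path_mul_ghostPath, Path.range_cons]
        exact if_congr (by simp [Path.cons_inj]) rfl rfl
      · rw [hzero hp, if_neg]
        rintro rfl; exact hp h
    · rw [ghost_mul_path_cons_of_ne hef, star_zero, mul_zero, map_zero]
      by_cases hp : E.rng e = p.source
      · rw [hcons hp, canonicalTrace_path_mul_ghostPath, if_neg]
        rw [Path.cons_inj]; exact fun h => hef h.1
      · exact hzero hp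

theorem canonicalTrace_ghost_mul (δ : V → R) (hδ : E.IsGraphTrace δ) (e : Ed)
    {y : LeavittPathAlgebra K E} (hy : y ∈ monomials K E) :
    canonicalTrace δ hδ (ghost K E e * y) = canonicalTrace δ hδ (y * ghost K E e) := by
  have hy' := star_mem_monomials hy
  have h1 : ghost K E e * y = star (star y * edge K E e) := by simp
  have h2 : y * ghost K E e = star (edge K E e * star y) := by simp
  rw [h2, canonicalTrace_star _ _ (edge_mul_mem_monomials e hy'),
    canonicalTrace_edge_mul _ _ _ hy', ← canonicalTrace_star _ _ (ghost_mul_mem_monomials e hy)]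
  simp

/-- The elements commuting with everything under the trace form a subalgebra: `T(aby) = T(bya) =
T(yab)`. For a generator, comparison with monomials suffices because they span. -/
theorem canonicalTrace_mul_comm (δ : V → R) (hδ : E.IsGraphTrace δ)
    (x y : LeavittPathAlgebra K E) :
    canonicalTrace δ hδ (x * y) = canonicalTrace δ hδ (y * x) := by
  have key : ∀ g : LeavittPathAlgebra K E, (∀ y ∈ monomials K E,
      canonicalTrace δ hδ (g * y) = canonicalTrace δ hδ (y * g)) → ∀ y,
      canonicalTrace δ hδ (g * y) = canonicalTrace δ hδ (y * g) := fun g hg y => by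
    have := LinearMap.ext_on (span_monomials (K := K) (E := E))
      (f := (canonicalTrace δ hδ).comp (LinearMap.mulLeft K g))
      (g := (canonicalTrace δ hδ).comp (LinearMap.mulRight K g)) hg
    exact LinearMap.congr_fun this y
  revert y
  induction x using generator_induction with
  | vertex x => exact key _ fun y => canonicalTrace_vertex_mul δ hδ x
  | edge e => exact key _ fun y => canonicalTrace_edge_mul δ hδ e
  | ghost e => exact key _ fun y => canonicalTrace_ghost_mul δ hδ e
  | zero =>
    intro y
    rw [zero_mul, mul_zero]
  | add a b ha hb =>
    intro y
    rw [add_mul, mul_add, map_add, map_add, ha, hb]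
  | mul a b ha hb =>
    intro y
    rw [mul_assoc, ha, mul_assoc, hb, mul_assoc]
  | smul k a ha =>
    intro y
    rw [smul_mul_assoc, mul_smul_comm, map_smul, map_smul, ha]

theorem eq_of_isCanonical {s t : LeavittPathAlgebra K E →ₗ[K] R} (hs : IsCanonical s)
    (ht : IsCanonical t) (h : ∀ x, s (vertex K E x) = t (vertex K E x)) : s = t := by
  refine LinearMap.ext_on (span_monomials (K := K) (E := E)) ?_
  rintro _ (rfl | ⟨p, q, rfl⟩)
  · rw [map_zero, map_zero]
  · rw [(hs p q).2.2, (ht p q).2.2, h]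

end trace

end star

end LeavittPathAlgebra

/-! ### Filtration by the length of the ghost part. -/

namespace LeavittPathAlgebra

open Leavitt DirGraph

variable {V : Type u} {Ed : Type v} {K : Type w} [Field K] {E : DirGraph V Ed}

variable (K E) in
/-- The linear span of the products `p q*` in which `q` has length at most `n`. -/
def ghostFiltration : ℕ → Submodule K (LeavittPathAlgebra K E)
  | 0 => Submodule.span K (Set.range (path K))
  | n + 1 => Submodule.span K (Set.range (path K)) ⊔
      ⨆ e : Ed, (ghostFiltration n).map (LinearMap.mulRight K (ghost K E e))

theorem span_path_le_ghostFiltration (n : ℕ) :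
    Submodule.span K (Set.range (path K)) ≤ ghostFiltration K E n := by
  cases n with
  | zero => exact le_rfl
  | succ n => exact le_sup_left

theorem ghostFiltration_monotone : Monotone (ghostFiltration K E) := by
  refine monotone_nat_of_le_succ fun n => ?_
  induction n with
  | zero => exact le_sup_left
  | succ n ih => exact sup_le_sup le_rfl (iSup_mono fun e => Submodule.map_mono ih)

theorem mul_ghost_mem_ghostFiltration {n : ℕ} {x : LeavittPathAlgebra K E}
    (hx : x ∈ ghostFiltration K E n) (e : Ed) : x * ghost K E e ∈ ghostFiltration K E (n + 1) :=
  (le_trans (le_iSup (fun e : Ed => (ghostFiltration K E n).map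
    (LinearMap.mulRight K (ghost K E e))) e) le_sup_right) ⟨x, hx, rfl⟩

theorem mul_edge_mem_span_path (e : Ed) {x : LeavittPathAlgebra K E}
    (hx : x ∈ Submodule.span K (Set.range (path K (E := E)))) :
    x * edge K E e ∈ Submodule.span K (Set.range (path K (E := E))) := by
  have : Submodule.span K (Set.range (path K (E := E))) ≤
      (Submodule.span K (Set.range (path K))).comap (LinearMap.mulRight K (edge K E e)) := by
    rw [Submodule.span_le]
    rintro _ ⟨p, rfl⟩
    change path K p * edge K E e ∈ Submodule.span K (Set.range (path K (E := E)))
    by_cases h : E.src e = p.range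
    · rw [← path_snoc p e h]
      exact Submodule.subset_span ⟨_, rfl⟩
    · rw [path_mul_edge_of_ne h]
      exact zero_mem _
  exact this hx

theorem mul_vertex_mem_ghostFiltration (x : V) {n : ℕ} {y : LeavittPathAlgebra K E}
    (hy : y ∈ ghostFiltration K E n) : y * vertex K E x ∈ ghostFiltration K E n := by
  have h0 : ∀ n, Submodule.span K (Set.range (path K (E := E))) ≤
      (ghostFiltration K E n).comap (LinearMap.mulRight K (vertex K E x)) := fun n => by
    rw [Submodule.span_le]
    rintro _ ⟨p, rfl⟩
    change path K p * vertex K E x ∈ ghostFiltration K E n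
    by_cases h : p.range = x
    · rw [← h, path_mul_vertex]
      exact span_path_le_ghostFiltration n (Submodule.subset_span ⟨_, rfl⟩)
    · rw [path_mul_vertex_of_ne h]
      exact zero_mem _
  have h1 : ghostFiltration K E n ≤
      (ghostFiltration K E n).comap (LinearMap.mulRight K (vertex K E x)) := by
    cases n with
    | zero => exact h0 0
    | succ n =>
      refine sup_le (h0 _) (iSup_le fun e => ?_)
      rintro _ ⟨y, hy, rfl⟩
      change y * ghost K E e * vertex K E x ∈ ghostFiltration K E (n + 1)
      rw [mul_assoc]
      by_cases h : E.src e = x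
      · rw [← h, ghost_mul_src]
        exact mul_ghost_mem_ghostFiltration hy e
      · rw [ghost_mul_vertex_of_ne h, mul_zero]
        exact zero_mem _
  exact h1 hy

theorem exists_sum_of_mem_ghostFiltration_succ {n : ℕ} {x : LeavittPathAlgebra K E}
    (hx : x ∈ ghostFiltration K E (n + 1)) :
    ∃ x₀ ∈ Submodule.span K (Set.range (path K (E := E))), ∃ (I : Finset Ed)
      (y : Ed → LeavittPathAlgebra K E), (∀ e, y e ∈ ghostFiltration K E n) ∧
        x = x₀ + ∑ e ∈ I, y e * ghost K E e := by
  obtain ⟨x₀, h₀, x₁, h₁, rfl⟩ := Submodule.mem_sup.1 hx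
  obtain ⟨f, hf, rfl⟩ := (Submodule.mem_iSup_iff_exists_finsupp _ _).1 h₁
  choose y hy hyf using hf
  refine ⟨x₀, h₀, f.support, y, hy, ?_⟩
  congr 1
  exact Finset.sum_congr rfl fun e _ => (hyf e).symm

section star

variable [StarRing K]

theorem path_mul_ghostPath_mem_ghostFiltration (p q : E.Path) :
    ∃ n, path K p * ghostPath K q ∈ ghostFiltration K E n := by
  induction q using Path.cons_induction with
  | nil x =>
    exact ⟨0, mul_vertex_mem_ghostFiltration (n := 0) x (Submodule.subset_span ⟨p, rfl⟩)⟩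
  | cons e q h ih =>
    obtain ⟨n, hn⟩ := ih
    refine ⟨n + 1, ?_⟩
    rw [ghostPath_cons, ← mul_assoc]
    exact mul_ghost_mem_ghostFiltration hn e

theorem exists_mem_ghostFiltration (x : LeavittPathAlgebra K E) :
    ∃ n, x ∈ ghostFiltration K E n := by
  have hx : x ∈ Submodule.span K (monomials K E) := by rw [span_monomials]; trivial
  induction hx using Submodule.span_induction with
  | mem x hx =>
    obtain rfl | ⟨p, q, rfl⟩ := hx
    · exact ⟨0, zero_mem _⟩
    · exact path_mul_ghostPath_mem_ghostFiltration p q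
  | zero => exact ⟨0, zero_mem _⟩
  | add x y _ _ hx hy =>
    obtain ⟨m, hm⟩ := hx
    obtain ⟨n, hn⟩ := hy
    exact ⟨max m n, add_mem (ghostFiltration_monotone (le_max_left m n) hm)
      (ghostFiltration_monotone (le_max_right m n) hn)⟩
  | smul k x _ hx =>
    obtain ⟨n, hn⟩ := hx
    exact ⟨n, Submodule.smul_mem _ k hn⟩

/-- A Pythagorean identity: mixed terms contain `ze = 0`, its adjoint, or `e*f = 0`. The condition
`hy` absorbs the vertex in `y_e e*e y_e* = y_e r(e) y_e*`. -/
theorem mul_star_self_of_orthogonal (I : Finset Ed) (z : LeavittPathAlgebra K E)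
    (y : Ed → LeavittPathAlgebra K E) (hz : ∀ e ∈ I, z * edge K E e = 0)
    (hy : ∀ e, y e * vertex K E (E.rng e) = y e) :
    (z + ∑ e ∈ I, y e * ghost K E e) * star (z + ∑ e ∈ I, y e * ghost K E e) =
      z * star z + ∑ e ∈ I, y e * star (y e) := by
  classical
  have h1 : star (∑ e ∈ I, y e * ghost K E e) = ∑ e ∈ I, edge K E e * star (y e) := by
    simp [star_sum]
  have h2 : z * ∑ e ∈ I, edge K E e * star (y e) = 0 := by
    rw [Finset.mul_sum]
    exact Finset.sum_eq_zero fun e he => by rw [← mul_assoc, hz e he, zero_mul]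
  have h3 : (∑ e ∈ I, y e * ghost K E e) * star z = 0 := by
    rw [← star_star (∑ e ∈ I, y e * ghost K E e), ← star_mul, h1, h2, star_zero]
  have h4 : (∑ e ∈ I, y e * ghost K E e) * ∑ e ∈ I, edge K E e * star (y e) =
      ∑ e ∈ I, y e * star (y e) := by
    rw [Finset.sum_mul_sum]
    refine Finset.sum_congr rfl fun e he => ?_
    rw [Finset.sum_eq_single e]
    · rw [← mul_assoc, mul_assoc (y e), ghost_mul_edge_self, hy]
    · intro f _ hf
      rw [← mul_assoc, mul_assoc (y e), ghost_mul_edge_of_ne hf.symm, mul_zero, zero_mul]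
    · exact fun h => absurd he h
  rw [star_add, h1, add_mul, mul_add, mul_add, h2, h3, h4, add_zero, zero_add]

/-! ### Positivity and faithfulness of canonical maps. -/

section positive

variable {R : Type*} [NonUnitalRing R] [Module K R]

omit [StarRing K] in
theorem IsCanonical.apply_of_ne {T : LeavittPathAlgebra K E →ₗ[K] R} (hT : IsCanonical T)
    {p q : E.Path} (h : p ≠ q) : T (path K p * ghostPath K q) = 0 := by
  rw [(hT p q).2.2, if_neg h]

omit [StarRing K] in
theorem IsCanonical.apply_self {T : LeavittPathAlgebra K E →ₗ[K] R} (hT : IsCanonical T)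
    (p : E.Path) : T (path K p * ghostPath K p) = T (vertex K E p.range) := by
  rw [(hT p p).2.2, if_pos rfl]

open Classical in
-- The argument is `(pe)(qe)*`, to which canonicity applies when `e` can be appended to both paths.
theorem IsCanonical.apply_edge_ghost {T : LeavittPathAlgebra K E →ₗ[K] R} (hT : IsCanonical T)
    (p q : E.Path) (e : Ed) :
    T (path K p * edge K E e * ghost K E e * ghostPath K q) =
      if p = q ∧ E.src e = p.range then T (vertex K E (E.rng e)) else 0 := by
  have hq : path K p * edge K E e * ghost K E e * ghostPath K q =
      path K p * edge K E e * star (path K q * edge K E e) := by simp [mul_assoc]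
  rw [hq]
  by_cases hp : E.src e = p.range
  · by_cases hq : E.src e = q.range
    · rw [← path_snoc p e hp, ← path_snoc q e hq, star_path]
      by_cases h : p = q
      · subst h
        rw [hT.apply_self, if_pos ⟨rfl, hp⟩, Path.range_snoc]
      · rw [hT.apply_of_ne (fun h' => h (Path.snoc_inj.1 h')), if_neg (fun h' => h h'.1)]
    · rw [path_mul_edge_of_ne hq, star_zero, mul_zero, map_zero, if_neg]
      rintro ⟨rfl, -⟩; exact hq hp
  · rw [path_mul_edge_of_ne hp, zero_mul, map_zero, if_neg fun h => hp h.2]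

/-- The element `p - ∑_{e ∈ I} p e e*`. -/
def cutPath (I : Finset Ed) (p : E.Path) : LeavittPathAlgebra K E :=
  path K p - ∑ e ∈ I, path K p * edge K E e * ghost K E e

omit [StarRing K] in
theorem sub_sum_edge_ghost_mul_edge (I : Finset Ed) (x : LeavittPathAlgebra K E) {e : Ed}
    (he : e ∈ I) : (x - ∑ f ∈ I, x * edge K E f * ghost K E f) * edge K E e = 0 := by
  rw [sub_mul, Finset.sum_mul, Finset.sum_eq_single_of_mem e he fun f _ hf => by
    rw [mul_assoc, ghost_mul_edge_of_ne hf, mul_zero], mul_assoc (x * _), ghost_mul_edge_self,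
    mul_assoc x, edge_mul_rng, sub_self]

open Classical in
-- A cut path is annihilated on the right by every `e ∈ I`, so the corrections in the second factor
-- drop out. A single `I` serves all paths at once; its edges not starting at `r(p)` contribute
-- nothing, hence the filter.
theorem IsCanonical.apply_cutPath {T : LeavittPathAlgebra K E →ₗ[K] R} (hT : IsCanonical T)
    (I : Finset Ed) (p q : E.Path) :
    T (cutPath I p * star (cutPath I q)) = if p = q then
      T (vertex K E p.range) - ∑ e ∈ I with E.src e = p.range, T (vertex K E (E.rng e)) else 0 := by
  have h1 : cutPath I p * star (cutPath I q) = cutPath (K := K) I p * ghostPath K q := by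
    have : star (cutPath (K := K) I q) =
        ghostPath K q - ∑ e ∈ I, edge K E e * (ghost K E e * ghostPath K q) := by
      simp [cutPath, star_sum]
    rw [this, mul_sub, Finset.mul_sum, Finset.sum_eq_zero, sub_zero]
    intro e he
    rw [← mul_assoc, cutPath, sub_sum_edge_ghost_mul_edge I _ he, zero_mul]
  rw [h1, cutPath, sub_mul, Finset.sum_mul, map_sub, map_sum]
  simp_rw [hT.apply_edge_ghost]
  split_ifs with h
  · subst h
    rw [hT.apply_self, Finset.sum_filter]
    simp
  · rw [hT.apply_of_ne h]
    simp [h]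

omit [StarRing K] in
theorem cutPath_eq_zero (I : Finset Ed) (p : E.Path) (hI : ∃ e, E.src e = p.range)
    (h : ∀ e, E.src e = p.range → e ∈ I) : cutPath (K := K) I p = 0 := by
  classical
  have hs : ∑ e ∈ I, path K p * edge K E e * ghost K E e =
      ∑ e ∈ I with E.src e = p.range, path K p * edge K E e * ghost K E e := by
    rw [Finset.sum_filter]
    refine Finset.sum_congr rfl fun e _ => ?_
    split_ifs with he
    · rfl
    · rw [path_mul_edge_of_ne he, zero_mul]
  rw [cutPath, hs, sub_eq_zero]
  obtain ⟨e, he⟩ := hI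
  conv_lhs => rw [← path_mul_vertex, vertex_eq_sum p.range (I.filter fun e => E.src e = p.range)
    ⟨e, by simp [he, h]⟩ (fun f => by simpa using h f), Finset.mul_sum]
  simp only [mul_assoc]

theorem IsCanonical.apply_sum_cutPath {T : LeavittPathAlgebra K E →ₗ[K] R} (hT : IsCanonical T)
    (I : Finset Ed) (s : Finset E.Path) (c : E.Path → K) :
    T ((∑ p ∈ s, c p • cutPath I p) * star (∑ p ∈ s, c p • cutPath I p)) =
      ∑ p ∈ s, (c p * star (c p)) • T (cutPath I p * star (cutPath I p)) := by
  classical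
  simp_rw [star_sum, star_smul, Finset.sum_mul_sum, map_sum, smul_mul_smul_comm, map_smul]
  refine Finset.sum_congr rfl fun p hp => ?_
  refine Finset.sum_eq_single_of_mem p hp fun q _ hq => ?_
  rw [hT.apply_cutPath, if_neg hq.symm, smul_zero]

variable [StarRing R] [IsScalarTower K R R] [SMulCommClass K R R] [StarModule K R]

omit [IsScalarTower K R R] [SMulCommClass K R R] [StarModule K R] in
theorem IsCanonical.isPosElt_cutPath {T : LeavittPathAlgebra K E →ₗ[K] R} (hT : IsCanonical T)
    (hpos : E.IsPositiveOnGraph fun x => T (vertex K E x)) (I : Finset Ed) (p : E.Path) :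
    IsPosElt (T (cutPath I p * star (cutPath I p))) := by
  classical
  rw [hT.apply_cutPath, if_pos rfl]
  exact hpos p.range _ fun e he => by simpa using (Finset.mem_filter.1 he).2

omit [IsScalarTower K R R] [SMulCommClass K R R] [StarModule K R] in
-- The hypothesis says `δ(v) = ∑ δ(r(e))` over the edges of `I` leaving `v = r(p)`. As `δ` never
-- vanishes, `v` is not a sink, and an edge at `v` outside `I` would make both `δ(r(e))` and
-- `-δ(r(e))` positive. So `I` contains all edges leaving `v`, and (CK2) applies.
theorem IsCanonical.cutPath_eq_zero {T : LeavittPathAlgebra K E →ₗ[K] R} (hT : IsCanonical T)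
    (hpos : E.IsPositiveOnGraph fun x => T (vertex K E x)) (hR : IsPosDefStarRing R)
    (hne : ∀ x, T (vertex K E x) ≠ 0) (I : Finset Ed) (p : E.Path)
    (h : T (cutPath I p * star (cutPath I p)) = 0) : cutPath (K := K) I p = 0 := by
  classical
  rw [hT.apply_cutPath, if_pos rfl] at h
  have hI : ∀ e, E.src e = p.range → e ∈ I := by
    by_contra! hI
    obtain ⟨e, he, heI⟩ := hI
    -- Adding the missing edge `e` turns the difference, which is zero by `h`, into `-δ(r(e))`.
    have h1 := hpos p.range (insert e (I.filter fun e => E.src e = p.range)) (by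
      intro f hf
      rcases Finset.mem_insert.1 hf with rfl | hf
      · exact he
      · exact (Finset.mem_filter.1 hf).2)
    rw [Finset.sum_insert (by simp [heI]), sub_add_eq_sub_sub_swap, h, zero_sub] at h1
    have h2 : IsPosElt (T (vertex K E (E.rng e))) := by
      simpa using hpos (E.rng e) ∅ (by simp)
    exact hne _ (hR.eq_zero_of_add_eq_zero h2 h1 (add_neg_cancel _))
  refine LeavittPathAlgebra.cutPath_eq_zero I p ?_ hI
  by_contra! hex
  rw [Finset.filter_false_of_mem fun e _ => hex e, Finset.sum_empty, sub_zero] at h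
  exact hne _ h

/-- By linearity `z` is a combination of cut paths. These are orthogonal under `T`, so `T(zz*)` is a
sum of positive terms weighted by `cc*`, and `cc* ≠ 0` when `c ≠ 0`. -/
theorem IsCanonical.isPosElt_sub_sum {T : LeavittPathAlgebra K E →ₗ[K] R} (hT : IsCanonical T)
    (hpos : E.IsPositiveOnGraph fun x => T (vertex K E x)) (I : Finset Ed)
    {x z : LeavittPathAlgebra K E} (hx : x ∈ Submodule.span K (Set.range (path K)))
    (hz : z = x - ∑ e ∈ I, x * edge K E e * ghost K E e) :
    IsPosElt (T (z * star z)) ∧ (IsPosDefStarRing R → (∀ v, T (vertex K E v) ≠ 0) →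
      T (z * star z) = 0 → z = 0) := by
  obtain ⟨c, rfl⟩ := (Finsupp.mem_span_range_iff_exists_finsupp).1 hx
  have hzc : z = ∑ p ∈ c.support, c p • cutPath I p := by
    rw [hz, Finsupp.sum]
    simp_rw [cutPath, smul_sub, Finset.sum_sub_distrib, Finset.smul_sum, Finset.sum_mul]
    rw [Finset.sum_comm]
    simp_rw [smul_mul_assoc]
  have hp : ∀ p ∈ c.support, IsPosElt
      ((c p * star (c p)) • T (cutPath I p * star (cutPath I p))) := fun p _ =>
    (hT.isPosElt_cutPath hpos I p).smul (c p)
  rw [hzc, hT.apply_sum_cutPath]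
  refine ⟨IsPosElt.sum hp, fun hR hne h => Finset.sum_eq_zero fun p hpc => ?_⟩
  have h0 := hR.eq_zero_of_sum_eq_zero hp h p hpc
  have hc : c p * star (c p) ≠ 0 := by
    have := Finsupp.mem_support_iff.1 hpc
    exact mul_ne_zero this (star_ne_zero.2 this)
  rw [hT.cutPath_eq_zero hpos hR hne I p ((smul_eq_zero_iff_right hc).1 h0), smul_zero]

/-- Induction on the ghost filtration. Positivity and definiteness are proved together, since both
rest on the same orthogonal decomposition of `x`. -/
theorem IsCanonical.isPosElt_mul_star {T : LeavittPathAlgebra K E →ₗ[K] R} (hT : IsCanonical T)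
    (hpos : E.IsPositiveOnGraph fun x => T (vertex K E x)) (x : LeavittPathAlgebra K E) :
    IsPosElt (T (x * star x)) ∧ (IsPosDefStarRing R → (∀ v, T (vertex K E v) ≠ 0) →
      T (x * star x) = 0 → x = 0) := by
  obtain ⟨n, hn⟩ := exists_mem_ghostFiltration x
  induction n generalizing x with
  | zero => exact hT.isPosElt_sub_sum hpos ∅ hn (by simp)
  | succ n ih =>
    obtain ⟨x₀, h₀, I, y, hy, rfl⟩ := exists_sum_of_mem_ghostFiltration_succ hn
    set z := x₀ - ∑ e ∈ I, x₀ * edge K E e * ghost K E e with hz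
    -- The factor `r(e)` leaves `w_e e*` unchanged and provides the absorption needed for `e*e =
    -- r(e)`.
    set w : Ed → LeavittPathAlgebra K E :=
      fun e => (y e + x₀ * edge K E e) * vertex K E (E.rng e) with hw
    have hwmem : ∀ e, w e ∈ ghostFiltration K E n := fun e =>
      mul_vertex_mem_ghostFiltration _ (add_mem (hy e)
        (span_path_le_ghostFiltration n (mul_edge_mem_span_path e h₀)))
    have hxz : x₀ + ∑ e ∈ I, y e * ghost K E e = z + ∑ e ∈ I, w e * ghost K E e := by
      have : ∀ e, w e * ghost K E e = y e * ghost K E e + x₀ * edge K E e * ghost K E e :=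
        fun e => by rw [hw, mul_assoc, rng_mul_ghost, add_mul]
      simp_rw [this, Finset.sum_add_distrib, hz]
      abel
    have hzpos := hT.isPosElt_sub_sum hpos I h₀ hz
    have hwpos : ∀ e ∈ I, IsPosElt (T (w e * star (w e))) := fun e _ => (ih _ (hwmem e)).1
    rw [hxz, mul_star_self_of_orthogonal I z w
      (fun e he => by rw [hz, sub_sum_edge_ghost_mul_edge I x₀ he])
      (fun e => by rw [hw, mul_assoc, vertex_mul_self]), map_add, map_sum]
    refine ⟨hzpos.1.add (IsPosElt.sum hwpos), fun hR hne h => ?_⟩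
    have hz0 := hR.eq_zero_of_add_eq_zero hzpos.1 (IsPosElt.sum hwpos) h
    rw [hz0, zero_add] at h
    rw [hzpos.2 hR hne hz0, zero_add]
    refine Finset.sum_eq_zero fun e he => ?_
    rw [(ih _ (hwmem e)).2 hR hne (hR.eq_zero_of_sum_eq_zero hwpos h e he), zero_mul]

theorem IsCanonical.isPositiveMap {T : LeavittPathAlgebra K E →ₗ[K] R} (hT : IsCanonical T)
    (hpos : E.IsPositiveOnGraph fun x => T (vertex K E x)) : IsPositiveMap T := by
  rintro _ ⟨n, y, rfl⟩
  rw [map_sum]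
  exact IsPosElt.sum fun i _ => (hT.isPosElt_mul_star hpos (y i)).1

theorem IsCanonical.isFaithfulMap {T : LeavittPathAlgebra K E →ₗ[K] R} (hT : IsCanonical T)
    (hR : IsPosDefStarRing R) (hf : E.IsFaithfulOnGraph fun x => T (vertex K E x)) :
    IsFaithfulMap T := by
  rintro x ⟨hx, hx0⟩
  refine ⟨hT.isPositiveMap hf.1 x hx, fun h => hx0 ?_⟩
  obtain ⟨n, y, rfl⟩ := hx
  rw [map_sum] at h
  refine Finset.sum_eq_zero fun i hi => ?_
  rw [(hT.isPosElt_mul_star hf.1 (y i)).2 hR (fun v => (hf.2 v).2)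
    (hR.eq_zero_of_sum_eq_zero (fun j _ => (hT.isPosElt_mul_star hf.1 (y j)).1) h i hi), zero_mul]

end positive

/-- The element is a self-adjoint idempotent `g`, so `g = gg*`. -/
theorem isPosElt_vertex_sub_sum (x : V) (I : Finset Ed) (hI : ∀ e ∈ I, E.src e = x) :
    IsPosElt (vertex K E x - ∑ e ∈ I, edge K E e * ghost K E e) := by
  set g := vertex K E x - ∑ e ∈ I, edge K E e * ghost K E e with hg
  have hstar : star g = g := by simp [hg, star_sum]
  have hge : ∀ e ∈ I, g * edge K E e = 0 := fun e he => by
    rw [hg, sub_mul, Finset.sum_mul, Finset.sum_eq_single_of_mem e he fun f _ hf => by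
      rw [mul_assoc, ghost_mul_edge_of_ne hf, mul_zero], mul_assoc, ghost_mul_edge_self,
      edge_mul_rng, ← hI e he, src_mul_edge, sub_self]
  have hgx : g * vertex K E x = g := by
    rw [hg, sub_mul, vertex_mul_self, Finset.sum_mul]
    congr 1
    exact Finset.sum_congr rfl fun e he => by rw [mul_assoc, ← hI e he, ghost_mul_src]
  have hgg : g * star g = g := by
    rw [hstar]
    conv_lhs => rhs; rw [hg]
    rw [mul_sub, hgx, Finset.mul_sum, Finset.sum_eq_zero, sub_zero]
    exact fun e he => by rw [← mul_assoc, hge e he, zero_mul]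
  rw [← hgg]
  exact isPosElt_mul_star g

end star

/-! ### Restricting traces to vertices, and the correspondence. -/

section restriction

variable {R : Type*} [NonUnitalRing R] [Module K R] {T : LeavittPathAlgebra K E →ₗ[K] R}

theorem apply_sum_edge_mul_ghost (hT : IsTrace T) (I : Finset Ed) :
    T (∑ e ∈ I, edge K E e * ghost K E e) = ∑ e ∈ I, T (vertex K E (E.rng e)) := by
  rw [map_sum]
  exact Finset.sum_congr rfl fun e _ => by rw [hT.2, ghost_mul_edge_self]

theorem isGraphTrace_of_isTrace (hT : IsTrace T) : E.IsGraphTrace fun x => T (vertex K E x) := by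
  intro x I hI hne
  change T (vertex K E x) = _
  rw [vertex_eq_sum x I hne fun e => by rw [← Finset.mem_coe, hI]; rfl,
    apply_sum_edge_mul_ghost hT]

variable [StarRing K] [StarRing R]

theorem isPositiveOnGraph_of_isPositiveMap (hT : IsTrace T) (hpos : IsPositiveMap T) :
    E.IsPositiveOnGraph fun x => T (vertex K E x) := by
  intro x I hI
  rw [← apply_sum_edge_mul_ghost hT, ← map_sub]
  exact hpos _ (isPosElt_vertex_sub_sum x I fun e he => hI he)

/-- Faithfulness implies positivity because `T 0 = 0`. Strictness at a vertex needs
`vertex_ne_zero`, as `x = xx*` must be nonzero in the algebra. -/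
theorem isFaithfulOnGraph_of_isFaithfulMap (hT : IsTrace T) (hf : IsFaithfulMap T) :
    E.IsFaithfulOnGraph fun x => T (vertex K E x) := by
  refine ⟨isPositiveOnGraph_of_isPositiveMap hT fun x hx => ?_, fun x => hf _ ⟨?_, vertex_ne_zero x⟩⟩
  · by_cases h : x = 0
    · rw [h, map_zero]
      exact isPosElt_zero
    · exact (hf x ⟨hx, h⟩).1
  · simpa [vertex_mul_self] using isPosElt_mul_star (vertex K E x)

end restriction

variable {R : Type*} [NonUnitalRing R] [Module K R]

/-- A homogeneous trace as a linear map. -/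
def linearMapOfTrace (t : LeavittPathAlgebra K E → R) (ht : IsTrace t)
    (hl : IsScalarLinear K t) : LeavittPathAlgebra K E →ₗ[K] R where
  toFun := t
  map_add' := ht.1
  map_smul' := hl

variable (K E R) in
/-- Graph traces correspond to canonical, linear traces. -/
noncomputable def graphTraceEquiv [StarRing K] : {δ : V → R // E.IsGraphTrace δ} ≃
    {t : LeavittPathAlgebra K E → R // IsTrace t ∧ IsScalarLinear K t ∧ IsCanonical t} where
  toFun δ := ⟨canonicalTrace δ.1 δ.2, ⟨map_add _, canonicalTrace_mul_comm δ.1 δ.2⟩,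
    map_smul _, canonicalTrace_isCanonical δ.1 δ.2⟩
  invFun t := ⟨fun x => t.1 (vertex K E x),
    isGraphTrace_of_isTrace (T := linearMapOfTrace t.1 t.2.1 t.2.2.1) t.2.1⟩
  left_inv δ := Subtype.ext <| funext fun x => canonicalTrace_vertex δ.1 δ.2 x
  right_inv t := Subtype.ext <| congrArg DFunLike.coe <|
    eq_of_isCanonical (t := linearMapOfTrace t.1 t.2.1 t.2.2.1)
      (canonicalTrace_isCanonical _ _) t.2.2.2 fun x => canonicalTrace_vertex _ _ x

end LeavittPathAlgebra

theorem mainTheorem4 {V Ed K R : Type*} (E : DirGraph V Ed)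
    [Field K] [StarRing K]
    [NonUnitalRing R] [StarRing R] [Module K R] [IsScalarTower K R R] [SMulCommClass K R R]
    [StarModule K R] :
    ∃ τ : {δ : V → R // E.IsGraphTrace δ} ≃
        {t : LeavittPathAlgebra K E → R //
          IsTrace t ∧ IsScalarLinear K t ∧ LeavittPathAlgebra.IsCanonical t},
      (∀ δ x, (τ δ).1 (LeavittPathAlgebra.vertex K E x) = δ.1 x) ∧
      Set.BijOn τ {δ | E.IsPositiveOnGraph δ.1} {t | IsPositiveMap t.1} ∧
      (IsPosDefStarRing R →
        Set.BijOn τ {δ | E.IsFaithfulOnGraph δ.1} {t | IsFaithfulMap t.1}) := by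
  -- Rewriting `δ` as the restriction of its trace lets the results on canonical maps apply.
  -- Positive definiteness enters only in passing from a faithful graph trace to a faithful trace.
  have hv : ∀ δ : {δ : V → R // E.IsGraphTrace δ}, δ.1 = fun x =>
      LeavittPathAlgebra.canonicalTrace (K := K) δ.1 δ.2 (LeavittPathAlgebra.vertex K E x) :=
    fun δ => funext fun x => (LeavittPathAlgebra.canonicalTrace_vertex δ.1 δ.2 x).symm
  have hc := fun δ : {δ : V → R // E.IsGraphTrace δ} =>
    LeavittPathAlgebra.canonicalTrace_isCanonical (K := K) δ.1 δ.2
  have ht := fun δ => (LeavittPathAlgebra.graphTraceEquiv K E R δ).2.1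
  refine ⟨LeavittPathAlgebra.graphTraceEquiv K E R,
    fun δ x => LeavittPathAlgebra.canonicalTrace_vertex δ.1 δ.2 x,
    Equiv.bijOn _ fun δ => ⟨fun h => ?_, fun h => ?_⟩,
    fun hR => Equiv.bijOn _ fun δ => ⟨fun h => ?_, fun h => ?_⟩⟩
  · change E.IsPositiveOnGraph δ.1
    rw [hv δ]
    exact LeavittPathAlgebra.isPositiveOnGraph_of_isPositiveMap (ht δ) h
  · exact (hc δ).isPositiveMap (by rw [← hv δ]; exact h)
  · change E.IsFaithfulOnGraph δ.1
    rw [hv δ]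
    exact LeavittPathAlgebra.isFaithfulOnGraph_of_isFaithfulMap (ht δ) h
  · exact (hc δ).isFaithfulMap hR (by rw [← hv δ]; exact h)
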